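/- Let $V$ be a finite set whose elements carry weights $w(v)\ge 0$ (the unweighted case is $w\equiv 1$), write $|X|=\sum_{v\in X}w(v)$ for the weight of $X\subseteq V$, and let $\mathcal P,\mathcal P'$ be partitions of $V$, where $\mathcal P$ has at least two parts. For $\mathcal S\subseteq\mathcal P$ and $\mathcal S'\subseteq\mathcal P'$ let $U_{\mathcal S}$, $U_{\mathcal S'}$ be the unions of their members, $\phi(\mathcal S,\mathcal S')=|U_{\mathcal S}\,\triangle\,U_{\mathcal S'}|$ and $\phi_{\mathcal P'}(\mathcal S)=\min_{\mathcal S'\subseteq\mathcal P'}\phi(\mathcal S,\mathcal S')$. A $C_{\mathcal P}$-correspondence is a pair $(\mathcal S,\mathcal S')$ with $\mathcal S\subseteq\mathcal P$, $\mathcal S'\subseteq\mathcal P'$ and $\mathcal S\notin\{\emptyset,\mathcal P\}$; it is optimal if it minimizes $\phi$ among all $C_{\mathcal P}$-correspondences. In what follows, $n$, $n'$ and $N$ denote the numbers of elements of $\mathcal P$, $\mathcal P'$ and $V$. On a random access machine with unit costs (natural numbers and reals; addition, subtraction, comparison; indirect addressing), given for each $v\in V$ its weight and the indices of the parts of $\mathcal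 P$ and $\mathcal P'$ that contain it, an optimal $C_{\mathcal P}$-correspondence $(\mathcal S,\mathcal S')$ can be found in time $O(N+n^4n')$, as follows. After a preparation phase, a general procedure for symmetric submodular minimization, applied to $\phi_{\mathcal P'}$ with $O(n^3)$ evaluations of $\phi_{\mathcal P'}$, finds a minimizer $\mathcal S$ of $\phi_{\mathcal P'}$ over all $\mathcal S\subseteq\mathcal P$ with $\mathcal S\notin\{\emptyset,\mathcal P\}$; then $\mathcal S'=\{P'\in\mathcal P' : |U_{\mathcal S}\cap P'|>|P'|/2\}$ is computed. Here the procedure is one and the same program for all inputs, which has access to the function to be minimized only through calls that return its value at a given set, and which, for every $m\ge 2$ and every symmetric submodular function $f$ on the subsets of a set of $m$ elements (that is, $f(X)=f(X^c)$ and $f(X\cup Y)\le f(X)+f(Y)-f(X\cap Y)$), finds a minimizer of $f$ over the subsets other than the empty set and the whole set, with $O(m^3)$ evaluations of $f$ and $O(m^4)$ operations if an evaluation is counted as one. -/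

import Mathlib

open Finset

namespace Corr

/-! ### A random access machine with unit costs

The machine has registers and one-dimensional arrays that hold natural numbers (indices, counters,
flags), and registers and arrays that hold real numbers (weights, function values). The only
arithmetic operations are addition and subtraction, on natural numbers (truncated) and on reals;
numbers of either kind can be compared. An array cell is addressed by a computed natural number.
Programs are structured (sequence, branch, loop) and may call one subroutine. -/

/-- The contents of the memory. -/
structure State where
  /-- natural number registers -/
  nat : ℕ → ℕ
  /-- real number registers -/
  real : ℕ → ℝ
  /-- `natArr a i` is cell `i` of the natural number array `a` -/
  natArr : ℕ → ℕ → ℕ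
  /-- `realArr a i` is cell `i` of the real number array `a` -/
  realArr : ℕ → ℕ → ℝ

namespace State

/-- Overwrite a natural number register. -/
def setNat (s : State) (x : ℕ) (m : ℕ) : State :=
  { s with nat := Function.update s.nat x m }

/-- Overwrite a real number register. -/
noncomputable def setReal (s : State) (x : ℕ) (r : ℝ) : State :=
  { s with real := Function.update s.real x r }

/-- Overwrite a cell of a natural number array. -/
def setNatArr (s : State) (a i : ℕ) (m : ℕ) : State :=
  { s with natArr := Function.update s.natArr a (Function.update (s.natArr a) i m) }

/-- Overwrite a cell of a real number array. -/
noncomputable def setRealArr (s : State) (a i : ℕ) (r : ℝ) : State :=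
  { s with realArr := Function.update s.realArr a (Function.update (s.realArr a) i r) }

end State

/-- Expressions with a natural number as value. -/
inductive NatExpr where
  | const (c : ℕ)
  | reg (x : ℕ)
  | get (a : ℕ) (i : NatExpr)
  | add (e f : NatExpr)
  | sub (e f : NatExpr)

namespace NatExpr

/-- The value of an expression. -/
def eval (s : State) : NatExpr → ℕ
  | const c => c
  | reg x => s.nat x
  | get a i => s.natArr a (i.eval s)
  | add e f => e.eval s + f.eval s
  | sub e f => e.eval s - f.eval s

/-- The number of elementary operations that the evaluation takes. -/
def cost : NatExpr → ℕ
  | const _ => 1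
  | reg _ => 1
  | get _ i => i.cost + 1
  | add e f => e.cost + f.cost + 1
  | sub e f => e.cost + f.cost + 1

end NatExpr

/-- Expressions with a real number as value. -/
inductive RealExpr where
  | zero
  | reg (x : ℕ)
  | get (a : ℕ) (i : NatExpr)
  | add (e f : RealExpr)
  | sub (e f : RealExpr)

namespace RealExpr

/-- The value of an expression. -/
noncomputable def eval (s : State) : RealExpr → ℝ
  | zero => 0
  | reg x => s.real x
  | get a i => s.realArr a (i.eval s)
  | add e f => e.eval s + f.eval s
  | sub e f => e.eval s - f.eval s

/-- The number of elementary operations that the evaluation takes. -/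
def cost : RealExpr → ℕ
  | zero => 1
  | reg _ => 1
  | get _ i => i.cost + 1
  | add e f => e.cost + f.cost + 1
  | sub e f => e.cost + f.cost + 1

end RealExpr

/-- Tests. -/
inductive Test where
  | natLt (e f : NatExpr)
  | realLt (e f : RealExpr)
  | neg (b : Test)
  | conj (b c : Test)

namespace Test

/-- The truth value of a test. -/
def Holds (s : State) : Test → Prop
  | natLt e f => e.eval s < f.eval s
  | realLt e f => e.eval s < f.eval s
  | neg b => ¬ b.Holds s
  | conj b c => b.Holds s ∧ c.Holds s

/-- The number of elementary operations that the test takes. -/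
def cost : Test → ℕ
  | natLt e f => e.cost + f.cost + 1
  | realLt e f => e.cost + f.cost + 1
  | neg b => b.cost + 1
  | conj b c => b.cost + c.cost + 1

end Test

/-- Programs. -/
inductive Cmd where
  | nop
  | assignNat (x : ℕ) (e : NatExpr)
  | assignReal (x : ℕ) (e : RealExpr)
  | storeNat (a : ℕ) (i : NatExpr) (e : NatExpr)
  | storeReal (a : ℕ) (i : NatExpr) (e : RealExpr)
  | seq (c d : Cmd)
  | branch (b : Test) (c d : Cmd)
  | loop (b : Test) (c : Cmd)
  | call

/-- `Exec Q c s s' t q`: started in `s`, the program `c` halts in `s'` after `t` elementary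
operations, the operations inside the subroutine included, and `q` calls of the subroutine.
Here `Q s s' t` says that one call of the subroutine turns `s` into `s'` within `t` operations. -/
inductive Exec (Q : State → State → ℕ → Prop) : Cmd → State → State → ℕ → ℕ → Prop
  | nop (s : State) : Exec Q .nop s s 1 0
  | assignNat (s : State) (x : ℕ) (e : NatExpr) :
      Exec Q (.assignNat x e) s (s.setNat x (e.eval s)) (e.cost + 1) 0
  | assignReal (s : State) (x : ℕ) (e : RealExpr) :
      Exec Q (.assignReal x e) s (s.setReal x (e.eval s)) (e.cost + 1) 0
  | storeNat (s : State) (a : ℕ) (i e : NatExpr) :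
      Exec Q (.storeNat a i e) s (s.setNatArr a (i.eval s) (e.eval s)) (i.cost + e.cost + 1) 0
  | storeReal (s : State) (a : ℕ) (i : NatExpr) (e : RealExpr) :
      Exec Q (.storeReal a i e) s (s.setRealArr a (i.eval s) (e.eval s)) (i.cost + e.cost + 1) 0
  | seq {c d : Cmd} {s₁ s₂ s₃ : State} {t₁ t₂ q₁ q₂ : ℕ}
      (h₁ : Exec Q c s₁ s₂ t₁ q₁) (h₂ : Exec Q d s₂ s₃ t₂ q₂) :
      Exec Q (.seq c d) s₁ s₃ (t₁ + t₂) (q₁ + q₂)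
  | branch_true {b : Test} {c d : Cmd} {s s' : State} {t q : ℕ}
      (hb : b.Holds s) (h : Exec Q c s s' t q) :
      Exec Q (.branch b c d) s s' (b.cost + 1 + t) q
  | branch_false {b : Test} {c d : Cmd} {s s' : State} {t q : ℕ}
      (hb : ¬ b.Holds s) (h : Exec Q d s s' t q) :
      Exec Q (.branch b c d) s s' (b.cost + 1 + t) q
  | loop_false {b : Test} {c : Cmd} {s : State} (hb : ¬ b.Holds s) :
      Exec Q (.loop b c) s s (b.cost + 1) 0
  | loop_true {b : Test} {c : Cmd} {s₁ s₂ s₃ : State} {t₁ t₂ q₁ q₂ : ℕ} (hb : b.Holds s₁)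
      (h₁ : Exec Q c s₁ s₂ t₁ q₁) (h₂ : Exec Q (.loop b c) s₂ s₃ t₂ q₂) :
      Exec Q (.loop b c) s₁ s₃ (b.cost + 1 + t₁ + t₂) (q₁ + q₂)
  | call {s s' : State} {t : ℕ} (h : Q s s' t) : Exec Q .call s s' (t + 1) 1

/-! ### Conventions for input and output -/

/-- Natural number register with the size of the ground set, the number of parts of `𝒫`. -/
abbrev sizeReg : ℕ := 0
/-- Natural number register with `|V|`. -/
abbrev numElemReg : ℕ := 1
/-- Natural number register with the number of parts of `𝒫'`. -/
abbrev numPartsReg' : ℕ := 2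
/-- Natural number array: the index of the part of `𝒫` that contains an element. -/
abbrev labelArr : ℕ := 0
/-- Natural number array: the index of the part of `𝒫'` that contains an element. -/
abbrev labelArr' : ℕ := 1
/-- Real number array: the weights of the elements. -/
abbrev weightArr : ℕ := 0
/-- Natural number array: the set that is passed to the subroutine. -/
abbrev queryArr : ℕ := 2
/-- Real number register: the value that the subroutine returns. -/
abbrev answerReg : ℕ := 0
/-- Natural number array: the computed set `𝒮`. -/
abbrev outArr : ℕ := 3
/-- Natural number array: the computed set `𝒮'`. -/
abbrev outArr' : ℕ := 4

/-- The subset of `{0, …, n - 1}` whose characteristic vector is stored in array `a`. -/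
def State.readSet (s : State) (a n : ℕ) : Finset (Fin n) :=
  univ.filter fun i => s.natArr a i ≠ 0

/-! ### Symmetric submodular functions and their minimization -/

/-- Symmetric set functions on the subsets of `{0, …, n - 1}`. -/
def IsSymmetric {n : ℕ} (f : Finset (Fin n) → ℝ) : Prop :=
  ∀ S, f S = f Sᶜ

/-- Submodular set functions on the subsets of `{0, …, n - 1}`. -/
def IsSubmodular {n : ℕ} (f : Finset (Fin n) → ℝ) : Prop :=
  ∀ S T, f (S ∪ T) ≤ f S + f T - f (S ∩ T)

/-- The subroutine is an oracle for `f`: one call returns the value of `f` at the query set, takes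
one unit of time and changes nothing else. -/
def oracle {n : ℕ} (f : Finset (Fin n) → ℝ) (s s' : State) (t : ℕ) : Prop :=
  s' = s.setReal answerReg (f (s.readSet queryArr n)) ∧ t = 1

/-- The program `A` minimizes every symmetric submodular function `f` on every ground set with
`n ≥ 2` elements over the sets other than the empty set and the ground set; it is given only `n`
and an oracle for `f`, it calls the oracle at most `C * n ^ 3` times, and it performs at most
`C * n ^ 4` operations, a call of the oracle counted as one. -/
def MinimizesSymmetricSubmodular (A : Cmd) (C : ℕ) : Prop :=
  ∀ (n : ℕ) (f : Finset (Fin n) → ℝ), 2 ≤ n → IsSymmetric f → IsSubmodular f →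
    ∀ s : State, s.nat sizeReg = n →
      ∃ (s' : State) (t q : ℕ), Exec (oracle f) A s s' t q ∧
        q ≤ C * n ^ 3 ∧ t ≤ C * n ^ 4 ∧
        s'.readSet outArr n ≠ ∅ ∧ s'.readSet outArr n ≠ univ ∧
        ∀ T : Finset (Fin n), T ≠ ∅ → T ≠ univ → f (s'.readSet outArr n) ≤ f T

/-! ### Correspondences between two partitions -/

section Correspondences

variable {V : Type*} [Fintype V] [DecidableEq V]

/-- The total weight of a set of elements. -/
def weight (w : V → ℝ) (X : Finset V) : ℝ := ∑ v ∈ X, w v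

/-- The union `U_𝒮` of all members of `𝒮`. -/
def unionOf (S : Finset (Finset V)) : Finset V := S.biUnion id

/-- `φ(𝒮, 𝒮') = |U_𝒮 ∆ U_𝒮'|`. -/
def phi (w : V → ℝ) (S S' : Finset (Finset V)) : ℝ :=
  weight w (symmDiff (unionOf S) (unionOf S'))

/-- `φ_𝒫'(𝒮)`, the minimum of `φ(𝒮, 𝒮')` over all `𝒮' ⊆ 𝒫'`. -/
noncomputable def phiMin (w : V → ℝ) (P' : Finpartition (univ : Finset V))
    (S : Finset (Finset V)) : ℝ :=
  P'.parts.powerset.inf' ⟨∅, empty_mem_powerset _⟩ fun S' => phi w S S'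

/-- The partner of `𝒮` that consists of the parts of `𝒫'` of which more than one half is covered
by `U_𝒮`. -/
noncomputable def partner (w : V → ℝ) (P' : Finpartition (univ : Finset V))
    (S : Finset (Finset V)) : Finset (Finset V) :=
  P'.parts.filter fun X => weight w X / 2 < weight w (unionOf S ∩ X)

/-- `(𝒮, 𝒮')` is a correspondence with `𝒮 ∉ {∅, 𝒫}`. -/
def IsCPCorrespondence (P P' : Finpartition (univ : Finset V)) (S S' : Finset (Finset V)) : Prop :=
  S ⊆ P.parts ∧ S' ⊆ P'.parts ∧ S ≠ ∅ ∧ S ≠ P.parts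

/-- `(𝒮, 𝒮')` minimizes `φ` among all correspondences with `𝒮 ∉ {∅, 𝒫}`. -/
def IsOptimalCPCorrespondence (w : V → ℝ) (P P' : Finpartition (univ : Finset V))
    (S S' : Finset (Finset V)) : Prop :=
  IsCPCorrespondence P P' S S' ∧
    ∀ T T', IsCPCorrespondence P P' T T' → phi w S S' ≤ phi w T T'

/-- The set of parts that a set of indices stands for, under a numbering of the parts. -/
def partsOf {P : Finpartition (univ : Finset V)} (e : Fin #P.parts ≃ P.parts)
    (X : Finset (Fin #P.parts)) : Finset (Finset V) :=
  X.image fun i => (e i : Finset V)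

/-- The memory holds the input: the three sizes, the indices of the two parts that contain an
element, and the weight of an element, under numberings of `V`, `𝒫` and `𝒫'`. All the rest of the
memory is arbitrary. -/
structure IsInput (s : State) (w : V → ℝ) (P P' : Finpartition (univ : Finset V))
    (eV : Fin (Fintype.card V) ≃ V) (e : Fin #P.parts ≃ P.parts)
    (e' : Fin #P'.parts ≃ P'.parts) : Prop where
  numElem : s.nat numElemReg = Fintype.card V
  numParts : s.nat sizeReg = #P.parts
  numParts' : s.nat numPartsReg' = #P'.parts
  label : ∀ (v : Fin (Fintype.card V)) (i : Fin #P.parts), eV v ∈ (e i : Finset V) →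
    s.natArr labelArr v = i
  label' : ∀ (v : Fin (Fintype.card V)) (i : Fin #P'.parts), eV v ∈ (e' i : Finset V) →
    s.natArr labelArr' v = i
  weights : ∀ v : Fin (Fintype.card V), s.realArr weightArr v = w (eV v)

/-- The subroutine is the program `E` (which has no subroutine itself), and the call from `s` to
`s'` returns `φ_𝒫'(𝒮)`, where `𝒮` is the query set. -/
def evaluation (E : Cmd) (w : V → ℝ) (P P' : Finpartition (univ : Finset V))
    (e : Fin #P.parts ≃ P.parts) (s s' : State) (t : ℕ) : Prop :=
  Exec (fun _ _ _ => False) E s s' t 0 ∧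
    s'.real answerReg = phiMin w P' (partsOf e (s.readSet queryArr #P.parts))

end Correspondences

end Corr

open Corr

namespace Corr

/-! ### A calculus for running times and memory changes -/

/-! The minimization is Queyranne's algorithm. Call an order of the elements legal if each next
element `u` minimizes `f (W ∪ u) - f u`, where `W` is the set of its predecessors. By induction
along such an order, submodularity yields `f W + f u ≤ f (W \ X) + f (X ∪ u)` for every `u` outside
the initial segment `W` and every `X ⊆ W` that avoids the last member of `W` (`Pendant.step`). For
the complete order, symmetry turns this into the statement that the last element alone is optimal
among all sets separating it from the last but one (`PendantPair.le`). Once this set has been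
compared with the best one so far, the two elements may be merged: any better set contains both or
neither. The same applies to groups of merged elements. When one group is left, only the empty set
and the ground set are unions of groups, so the recorded set is a minimizer (`PhaseInv.step`,
`Computes.runs_queyranne`).

For correspondences, `φ(𝒮, 𝒮')` splits over the parts `X` of `𝒫'`: a part costs `|X \ U_𝒮|` if it
belongs to `𝒮'` and `|U_𝒮 ∩ X|` otherwise. The best `𝒮'` is thus found part by part, by the majority
rule, and `φ_𝒫'(𝒮)` is the sum of the smaller halves (`phi_partner`, `phiMin_eq_phi_partner`). Each
summand is the concave function `min x (c - x)` of a nonnegative modular set function, hence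
symmetric and submodular (`isSubmodular_halves`).

There are `n` phases with `n` steps and at most `n` candidates each, so `O(n³)` evaluations, and
each query takes `O(n)` to write down. A table of the `n * n'` overlaps, built in `O(N + n n')`,
reduces an evaluation to `O(n n')`. The analysis of the program is carried out for an abstract
subroutine of cost `τ` that respects a fixed memory region (`Computes`). It therefore serves both
the oracle and the concrete evaluation program. -/

/-- A set of registers and arrays. -/
structure Region where
  /-- natural number registers -/
  nat : List ℕ
  /-- real number registers -/
  real : List ℕ
  /-- natural number arrays -/
  natArr : List ℕ
  /-- real number arrays -/
  realArr : List ℕ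

/-- The union of two regions. -/
def Region.union (A B : Region) : Region :=
  ⟨A.nat ++ B.nat, A.real ++ B.real, A.natArr ++ B.natArr, A.realArr ++ B.realArr⟩

/-- The memory contents `s` and `s'` agree outside the region `W`. -/
structure Agree (W : Region) (s s' : State) : Prop where
  nat : ∀ x, x ∉ W.nat → s'.nat x = s.nat x
  real : ∀ x, x ∉ W.real → s'.real x = s.real x
  natArr : ∀ a, a ∉ W.natArr → s'.natArr a = s.natArr a
  realArr : ∀ a, a ∉ W.realArr → s'.realArr a = s.realArr a

theorem Agree.refl (W : Region) (s : State) : Agree W s s :=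
  ⟨fun _ _ => rfl, fun _ _ => rfl, fun _ _ => rfl, fun _ _ => rfl⟩

theorem Agree.trans {W : Region} {s s' s'' : State} (h : Agree W s s') (h' : Agree W s' s'') :
    Agree W s s'' :=
  ⟨fun x hx => (h'.nat x hx).trans (h.nat x hx), fun x hx => (h'.real x hx).trans (h.real x hx),
    fun x hx => (h'.natArr x hx).trans (h.natArr x hx),
    fun x hx => (h'.realArr x hx).trans (h.realArr x hx)⟩

theorem Agree.mono {W W' : Region} {s s' : State} (h : Agree W s s') (h₁ : W.nat ⊆ W'.nat)
    (h₂ : W.real ⊆ W'.real) (h₃ : W.natArr ⊆ W'.natArr) (h₄ : W.realArr ⊆ W'.realArr) :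
    Agree W' s s' :=
  ⟨fun x hx => h.nat x fun hh => hx (h₁ hh), fun x hx => h.real x fun hh => hx (h₂ hh),
    fun x hx => h.natArr x fun hh => hx (h₃ hh), fun x hx => h.realArr x fun hh => hx (h₄ hh)⟩

theorem Agree.union_left {A : Region} {s s' : State} (h : Agree A s s') (B : Region) :
    Agree (A.union B) s s' :=
  h.mono (List.subset_append_left _ _) (List.subset_append_left _ _)
    (List.subset_append_left _ _) (List.subset_append_left _ _)

theorem Agree.union_right {B : Region} {s s' : State} (h : Agree B s s') (A : Region) :
    Agree (A.union B) s s' :=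
  h.mono (List.subset_append_right _ _) (List.subset_append_right _ _)
    (List.subset_append_right _ _) (List.subset_append_right _ _)

/-- The region that a program may change, if its subroutine may change `W`. -/
def Cmd.writes (W : Region) : Cmd → Region
  | .nop => ⟨[], [], [], []⟩
  | .assignNat x _ => ⟨[x], [], [], []⟩
  | .assignReal x _ => ⟨[], [x], [], []⟩
  | .storeNat a _ _ => ⟨[], [], [a], []⟩
  | .storeReal a _ _ => ⟨[], [], [], [a]⟩
  | .seq c d => (c.writes W).union (d.writes W)
  | .branch _ c d => (c.writes W).union (d.writes W)
  | .loop _ c => c.writes W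
  | .call => W

/-- The subroutine changes at most `W`. -/
def Frames (W : Region) (Q : State → State → ℕ → Prop) : Prop :=
  ∀ s s' t, Q s s' t → Agree W s s'

theorem Frames.false (W : Region) : Frames W fun _ _ _ => False := fun _ _ _ h => h.elim

theorem Agree.setNat (s : State) (x m : ℕ) : Agree ⟨[x], [], [], []⟩ s (s.setNat x m) :=
  ⟨fun y hy => by
    rw [List.mem_singleton] at hy; simp [State.setNat, Function.update_of_ne hy],
    fun _ _ => rfl, fun _ _ => rfl, fun _ _ => rfl⟩

/-- This is the frame rule. The written region is read off from the program text; for a concrete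
program it consists of lists of numerals, so that most claims that some memory is untouched reduce
to `decide`. -/
theorem Exec.agree {W : Region} {Q : State → State → ℕ → Prop} (hQ : Frames W Q) {c : Cmd}
    {s s' : State} {t q : ℕ} (h : Exec Q c s s' t q) : Agree (c.writes W) s s' := by
  induction h with
  | nop s => exact Agree.refl _ _
  | assignNat s x e => exact Agree.setNat _ _ _
  | assignReal s x e =>
    refine ⟨fun _ _ => rfl, fun y hy => ?_, fun _ _ => rfl, fun _ _ => rfl⟩
    simp only [Cmd.writes, List.mem_singleton] at hy
    simp [State.setReal, Function.update_of_ne hy]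
  | storeNat s a i e =>
    refine ⟨fun _ _ => rfl, fun _ _ => rfl, fun y hy => ?_, fun _ _ => rfl⟩
    simp only [Cmd.writes, List.mem_singleton] at hy
    simp [State.setNatArr, Function.update_of_ne hy]
  | storeReal s a i e =>
    refine ⟨fun _ _ => rfl, fun _ _ => rfl, fun _ _ => rfl, fun y hy => ?_⟩
    simp only [Cmd.writes, List.mem_singleton] at hy
    simp [State.setRealArr, Function.update_of_ne hy]
  | seq _ _ ih₁ ih₂ => exact (ih₁.union_left _).trans (ih₂.union_right _)
  | branch_true _ _ ih => exact ih.union_left _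
  | branch_false _ _ ih => exact ih.union_right _
  | loop_false _ => exact Agree.refl _ _
  | loop_true _ _ _ ih₁ ih₂ => exact ih₁.trans ih₂
  | call h => exact hQ _ _ _ h

/-- Started in `s`, the program `c` halts after at most `T` operations and at most `K` calls of the
subroutine in a state with the property `P`. -/
def Runs (Q : State → State → ℕ → Prop) (c : Cmd) (s : State) (T K : ℕ) (P : State → Prop) :
    Prop :=
  ∃ (s' : State) (t q : ℕ), Exec Q c s s' t q ∧ t ≤ T ∧ q ≤ K ∧ P s'

namespace Runs

variable {Q : State → State → ℕ → Prop} {W : Region} {c d : Cmd} {s : State} {T T' K K' : ℕ}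
  {P R : State → Prop}

theorem mono (h : Runs Q c s T K P) (hT : T ≤ T') (hK : K ≤ K') (hP : ∀ s', P s' → R s') :
    Runs Q c s T' K' R := by
  obtain ⟨s', t, q, h, ht, hq, hs⟩ := h
  exact ⟨s', t, q, h, ht.trans hT, hq.trans hK, hP _ hs⟩

theorem le (h : Runs Q c s T K P) (hT : T ≤ T') (hK : K ≤ K') : Runs Q c s T' K' P :=
  h.mono hT hK fun _ => id

theorem agree (hQ : Frames W Q) (h : Runs Q c s T K P) :
    Runs Q c s T K fun s' => P s' ∧ Agree (c.writes W) s s' := by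
  obtain ⟨s', t, q, h, ht, hq, hs⟩ := h
  exact ⟨s', t, q, h, ht, hq, hs, h.agree hQ⟩

theorem nop (h : P s) : Runs Q .nop s 1 0 P := ⟨_, _, _, .nop s, le_rfl, le_rfl, h⟩

theorem assignNat {x : ℕ} {e : NatExpr} (h : P (s.setNat x (e.eval s))) :
    Runs Q (.assignNat x e) s (e.cost + 1) 0 P :=
  ⟨_, _, _, .assignNat s x e, le_rfl, le_rfl, h⟩

theorem assignReal {x : ℕ} {e : RealExpr} (h : P (s.setReal x (e.eval s))) :
    Runs Q (.assignReal x e) s (e.cost + 1) 0 P :=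
  ⟨_, _, _, .assignReal s x e, le_rfl, le_rfl, h⟩

theorem storeNat {a : ℕ} {i e : NatExpr} (h : P (s.setNatArr a (i.eval s) (e.eval s))) :
    Runs Q (.storeNat a i e) s (i.cost + e.cost + 1) 0 P :=
  ⟨_, _, _, .storeNat s a i e, le_rfl, le_rfl, h⟩

theorem storeReal {a : ℕ} {i : NatExpr} {e : RealExpr}
    (h : P (s.setRealArr a (i.eval s) (e.eval s))) :
    Runs Q (.storeReal a i e) s (i.cost + e.cost + 1) 0 P :=
  ⟨_, _, _, .storeReal s a i e, le_rfl, le_rfl, h⟩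

theorem seq (h₁ : Runs Q c s T K P) (h₂ : ∀ s', P s' → Runs Q d s' T' K' R) :
    Runs Q (.seq c d) s (T + T') (K + K') R := by
  obtain ⟨s', t, q, h, ht, hq, hs⟩ := h₁
  obtain ⟨s'', t', q', h', ht', hq', hs'⟩ := h₂ s' hs
  exact ⟨s'', _, _, h.seq h', by omega, by omega, hs'⟩

theorem seq_agree (hQ : Frames W Q) (h₁ : Runs Q c s T K P)
    (h₂ : ∀ s', P s' → Agree (c.writes W) s s' → Runs Q d s' T' K' R) :
    Runs Q (.seq c d) s (T + T') (K + K') R :=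
  (h₁.agree hQ).seq fun s' hs' => h₂ s' hs'.1 hs'.2

theorem branch {b : Test} (h₁ : b.Holds s → Runs Q c s T K P)
    (h₂ : ¬ b.Holds s → Runs Q d s T' K' P) :
    Runs Q (.branch b c d) s (b.cost + 1 + max T T') (max K K') P := by
  by_cases hb : b.Holds s
  · obtain ⟨s', t, q, h, ht, hq, hs⟩ := h₁ hb
    exact ⟨s', _, _, .branch_true hb h, by omega, by omega, hs⟩
  · obtain ⟨s', t, q, h, ht, hq, hs⟩ := h₂ hb
    exact ⟨s', _, _, .branch_false hb h, by omega, by omega, hs⟩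

end Runs

/-- Run `c` for the values `0, 1, …` of the register `x` that are less than register `b`. -/
def forTo (x b : ℕ) (c : Cmd) : Cmd :=
  .seq (.assignNat x (.const 0))
    (.loop (.natLt (.reg x) (.reg b)) (.seq c (.assignNat x (.add (.reg x) (.const 1)))))

/-- A round costs 4 for the test and 4 for the increment besides the body; the remaining 6 are the
initialization and the failing last test. The body is given agreement with the start state, so the
invariant `I` need only speak of memory that the loop changes. -/
theorem Runs.forTo {Q : State → State → ℕ → Prop} {W : Region} (hQ : Frames W Q) {c : Cmd}
    {s : State} {x b n T K : ℕ} (I : ℕ → State → Prop) (hn : s.nat b = n) (hbx : b ≠ x)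
    (hx : x ∉ (c.writes W).nat) (hb : b ∉ (c.writes W).nat) (h₀ : I 0 (s.setNat x 0))
    (hI : ∀ i s', i < n → I i s' → s'.nat x = i → Agree ((Corr.forTo x b c).writes W) s s' →
      Runs Q c s' T K fun s'' => I (i + 1) (s''.setNat x (i + 1))) :
    Runs Q (Corr.forTo x b c) s (n * (T + 8) + 6) (n * K) (I n) := by
  -- Induction on the number `k` of rounds that are left.
  have key : ∀ k i s', i + k = n → I i s' → s'.nat x = i →
      Agree ((Corr.forTo x b c).writes W) s s' →
      Runs Q (.loop (.natLt (.reg x) (.reg b)) (.seq c (.assignNat x (.add (.reg x) (.const 1)))))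
        s' (k * (T + 8) + 4) (k * K) (I n) := by
    have hbw : b ∉ ((Corr.forTo x b c).writes W).nat := by
      simp [Corr.forTo, Cmd.writes, Region.union, hbx, hb]
    intro k
    induction k with
    | zero =>
      intro i s' hi hs hxi hA
      have hi' : i = n := by omega
      subst hi'
      refine ⟨s', _, _, .loop_false ?_, by simp [Test.cost, NatExpr.cost], by simp, hs⟩
      simp [Test.Holds, NatExpr.eval, hxi, hA.nat b hbw, hn]
    | succ k ih =>
      intro i s' hi hs hxi hA
      obtain ⟨s₁, t₁, q₁, h₁, ht₁, hq₁, hs₁⟩ := hI i s' (by omega) hs hxi hA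
      have hA₁ := h₁.agree hQ
      have hx₁ : s₁.nat x = i := (hA₁.nat x hx).trans hxi
      have h₂ : Exec Q (.seq c (.assignNat x (.add (.reg x) (.const 1)))) s'
          (s₁.setNat x (i + 1)) (t₁ + 4) (q₁ + 0) := by
        have := h₁.seq (.assignNat s₁ x (.add (.reg x) (.const 1)))
        simpa [NatExpr.eval, NatExpr.cost, hx₁] using this
      have hA₂ : Agree ((Corr.forTo x b c).writes W) s' (s₁.setNat x (i + 1)) :=
        (h₂.agree hQ).union_right _
      obtain ⟨s₂, t₂, q₂, h₃, ht₂, hq₂, hs₂⟩ := ih (i + 1) _ (by omega) hs₁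
        (by simp [State.setNat]) (hA.trans hA₂)
      refine ⟨s₂, _, _, .loop_true ?_ h₂ h₃, ?_, ?_, hs₂⟩
      · simp [Test.Holds, NatExpr.eval, hxi, hA.nat b hbw, hn]; omega
      · simp only [Test.cost, NatExpr.cost]; rw [Nat.add_mul]; omega
      · rw [Nat.add_mul]; omega
  have h0A : Agree ((Corr.forTo x b c).writes W) s (s.setNat x 0) :=
    (Agree.setNat s x 0).union_left _
  have h := key n 0 (s.setNat x 0) (by omega) h₀ (by simp [State.setNat]) h0A
  refine Runs.le (Runs.seq (P := fun s' => s' = s.setNat x 0) (Runs.assignNat rfl) ?_)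
    (T := 2 + (n * (T + 8) + 4)) (K := 0 + n * K) (by omega) (by omega)
  rintro s' rfl
  exact h

/-- Equality of natural numbers. -/
def natEq (e f : NatExpr) : Test := .conj (.neg (.natLt e f)) (.neg (.natLt f e))

theorem holds_natEq {e f : NatExpr} {s : State} : (natEq e f).Holds s ↔ e.eval s = f.eval s := by
  simp only [natEq, Test.Holds]; omega

/-! ### Pendant pairs of symmetric submodular functions -/

section Pendant

variable {n : ℕ} {f : Finset (Fin n) → ℝ} {R : Fin n → ℕ}

/-- The elements with label `r`. -/
def group (R : Fin n → ℕ) (r : ℕ) : Finset (Fin n) := univ.filter fun i => R i = r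

theorem mem_group {r : ℕ} {i : Fin n} : i ∈ group R r ↔ R i = r := by simp [group]

/-- `X` is a union of groups. -/
def Compat (R : Fin n → ℕ) (X : Finset (Fin n)) : Prop :=
  ∀ i j, R i = R j → (i ∈ X ↔ j ∈ X)

theorem Compat.union {X Y : Finset (Fin n)} (hX : Compat R X) (hY : Compat R Y) :
    Compat R (X ∪ Y) := fun i j h => by simp only [mem_union, hX i j h, hY i j h]

theorem Compat.sdiff {X Y : Finset (Fin n)} (hX : Compat R X) (hY : Compat R Y) :
    Compat R (X \ Y) := fun i j h => by simp only [mem_sdiff, hX i j h, hY i j h]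

theorem Compat.compl {X : Finset (Fin n)} (hX : Compat R X) : Compat R Xᶜ :=
  fun i j h => by simp only [mem_compl, hX i j h]

theorem compat_group (r : ℕ) : Compat R (group R r) := fun i j h => by simp [mem_group, h]

/-- `W` is an initial segment of a legal order of the groups, the last member of which is `L`. -/
def Pendant (f : Finset (Fin n) → ℝ) (R : Fin n → ℕ) (W L : Finset (Fin n)) : Prop :=
  ∀ X, Compat R X → X ⊆ W \ L → ∀ u ∉ W,
    f W + f (group R (R u)) ≤ f (W \ X) + f (X ∪ group R (R u))

/-- `W` is an initial segment of a legal order of the groups, the last two members of which are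
`M` and `L`. -/
def PendantPair (f : Finset (Fin n) → ℝ) (R : Fin n → ℕ) (W M L : Finset (Fin n)) : Prop :=
  ∀ X, Compat R X → X ⊆ (W \ L) \ M → f (W \ L) + f L ≤ f ((W \ L) \ X) + f (X ∪ L)

theorem sdiff_group_eq {W : Finset (Fin n)} (hW : Compat R W) {v : Fin n} (hv : v ∉ W) :
    (W ∪ group R (R v)) \ group R (R v) = W := by
  ext i
  simp only [mem_sdiff, mem_union, mem_group]
  constructor
  · tauto
  · intro hi
    exact ⟨Or.inl hi, fun h => hv ((hW i v h).1 hi)⟩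

/-- This is the inequality of `Pendant` at the one element `v` that comes next; removing the new
group gives back `W`. -/
theorem Pendant.pair {W L : Finset (Fin n)} (h : Pendant f R W L) (hW : Compat R W) {v : Fin n}
    (hv : v ∉ W) : PendantPair f R (W ∪ group R (R v)) L (group R (R v)) := by
  intro X hX hXW
  rw [sdiff_group_eq hW hv] at hXW ⊢
  exact h X hX hXW v hv

/-- The inductive step of Queyranne's inequality, with groups in place of single elements. -/
theorem Pendant.step (hf : IsSubmodular f) {W : Finset (Fin n)} {l : ℕ}
    (h : Pendant f R W (group R l)) (hW : Compat R W) {v : Fin n} (hv : v ∉ W)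
    (hmin : ∀ u ∉ W, f (W ∪ group R (R v)) - f (group R (R v)) ≤
      f (W ∪ group R (R u)) - f (group R (R u))) :
    Pendant f R (W ∪ group R (R v)) (group R (R v)) := by
  intro X hX hXW u hu
  rw [sdiff_group_eq hW hv] at hXW
  have hdis : ∀ {i j : Fin n}, i ∈ W → j ∉ W → R i ≠ R j := fun hi hj h => hj ((hW _ _ h).1 hi)
  have huW : u ∉ W := fun h => hu (mem_union_left _ h)
  -- If `X` meets the last group of `W`, it contains it, so the hypothesis applies to `W \ X` and
  -- `v`; it is combined with submodularity for `X ∪ u` and `W` and with the minimality of the key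
  -- of `v`. Otherwise the hypothesis applies to `X` and `u`, and submodularity for `(W ∪ v) \ X`
  -- and `W` suffices, without minimality.
  by_cases hl : ∃ i ∈ X, R i = l
  · obtain ⟨i, hi, hil⟩ := hl
    have h₁ := h (W \ X) (hW.sdiff hX) (by
      intro j hj
      rw [mem_sdiff] at hj ⊢
      refine ⟨hj.1, fun hjl => hj.2 ?_⟩
      rw [mem_group] at hjl
      exact (hX i j (hil.trans hjl.symm)).1 hi) v hv
    have h₂ := hf (X ∪ group R (R u)) W
    have h₃ := hmin u huW
    have e₁ : W \ (W \ X) = X := by simpa using hXW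
    have e₂ : (W \ X) ∪ group R (R v) = (W ∪ group R (R v)) \ X := by
      ext j
      simp only [mem_sdiff, mem_union, mem_group]
      constructor
      · rintro (h | h)
        · exact ⟨Or.inl h.1, h.2⟩
        · exact ⟨Or.inr h, fun hj => hdis (hXW hj) hv h⟩
      · tauto
    have e₃ : X ∪ group R (R u) ∪ W = W ∪ group R (R u) := by
      ext j
      simp only [mem_union]
      have := @hXW j
      tauto
    have e₄ : (X ∪ group R (R u)) ∩ W = X := by
      ext j
      simp only [mem_union, mem_inter, mem_group]
      constructor
      · rintro ⟨h | h, hj⟩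
        · exact h
        · exact absurd h (hdis hj huW)
      · exact fun hj => ⟨Or.inl hj, hXW hj⟩
    rw [e₁, e₂] at h₁
    rw [e₃, e₄] at h₂
    linarith
  · have h₁ := h X hX (by
      intro j hj
      rw [mem_sdiff, mem_group]
      exact ⟨hXW hj, fun hjl => hl ⟨j, hj, hjl⟩⟩) u huW
    have h₂ := hf ((W ∪ group R (R v)) \ X) W
    have e₁ : (W ∪ group R (R v)) \ X ∪ W = W ∪ group R (R v) := by
      ext j
      simp only [mem_union, mem_sdiff]
      have := @hXW j
      tauto
    have e₂ : ((W ∪ group R (R v)) \ X) ∩ W = W \ X := by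
      ext j
      simp only [mem_union, mem_sdiff, mem_inter]
      tauto
    rw [e₁, e₂] at h₂
    linarith

/-- The last group of a legal order is optimal among the sets that separate it from the last but
one. -/
theorem PendantPair.le (hs : IsSymmetric f) {p l : ℕ}
    (h : PendantPair f R univ (group R p) (group R l)) {Y : Finset (Fin n)} (hY : Compat R Y)
    {i j : Fin n} (hi : R i = p) (hj : R j = l) (hij : ¬ (i ∈ Y ↔ j ∈ Y)) :
    f (group R l) ≤ f Y := by
  have key : ∀ Y : Finset (Fin n), Compat R Y → i ∉ Y → j ∈ Y → f (group R l) ≤ f Y := by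
    intro Y hY hiY hjY
    -- With this choice of `X` the inequality reads `f Lᶜ + f L ≤ f Yᶜ + f Y`, which by symmetry is
    -- twice the claim.
    have h₁ := h (Y \ group R l) (hY.sdiff (compat_group l)) (by
      intro k hk
      simp only [mem_sdiff, mem_group, mem_univ, true_and] at hk ⊢
      refine ⟨hk.2, fun hkp => hiY ((hY k i (hkp.trans hi.symm)).1 hk.1)⟩)
    have hlY : group R l ⊆ Y := fun k hk =>
      (hY j k (hj.trans (mem_group.1 hk).symm)).1 hjY
    have e₁ : univ \ group R l = (group R l)ᶜ := by ext; simp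
    have e₂ : (group R l)ᶜ \ (Y \ group R l) = Yᶜ := by
      ext k
      have := @hlY k
      simp only [mem_sdiff, mem_compl]
      tauto
    rw [e₁, e₂, ← hs, ← hs, sdiff_union_of_subset hlY] at h₁
    linarith
  by_cases hiY : i ∈ Y
  · have hjY : j ∉ Y := by tauto
    rw [hs Y]
    exact key _ hY.compl (by simpa using hiY) (by simpa using hjY)
  · exact key _ hY hiY (by tauto)

/-- Replace the label `l` by `p`. -/
def mergeLabels (R : Fin n → ℕ) (p l : ℕ) : Fin n → ℕ := fun i => if R i = l then p else R i

theorem Compat.merge {p l : ℕ} {Y : Finset (Fin n)} (hY : Compat R Y) {i j : Fin n}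
    (hi : R i = p) (hj : R j = l) (hij : i ∈ Y ↔ j ∈ Y) : Compat (mergeLabels R p l) Y := by
  have key : ∀ k, ∃ k', mergeLabels R p l k = R k' ∧ (k ∈ Y ↔ k' ∈ Y) := by
    intro k
    by_cases hk : R k = l
    · exact ⟨i, by simp [mergeLabels, hk, hi], by rw [hij]; exact hY _ _ (hk.trans hj.symm)⟩
    · exact ⟨k, by simp [mergeLabels, hk], Iff.rfl⟩
  intro a b hab
  obtain ⟨a', ha, ha'⟩ := key a
  obtain ⟨b', hb, hb'⟩ := key b
  rw [ha', hb']
  exact hY _ _ (by rw [← ha, ← hb, hab])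

/-- The label `l` disappears, and no label is new because `p` already occurs. This drives the
termination of the phases. -/
theorem card_image_mergeLabels {p l : ℕ} (hpl : p ≠ l) {i j : Fin n} (hi : R i = p)
    (hj : R j = l) : #(univ.image (mergeLabels R p l)) + 1 ≤ #(univ.image R) := by
  have hsub : univ.image (mergeLabels R p l) ⊆ (univ.image R).erase l := by
    intro x hx
    obtain ⟨k, -, rfl⟩ := mem_image.1 hx
    rw [mem_erase]
    by_cases hk : R k = l
    · simp only [mergeLabels, hk, if_true]
      exact ⟨hpl, mem_image.2 ⟨i, mem_univ _, hi⟩⟩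
    · simp only [mergeLabels, hk, if_false]
      exact ⟨hk, mem_image_of_mem _ (mem_univ _)⟩
  have h := card_le_card hsub
  have hl : l ∈ univ.image R := mem_image.2 ⟨j, mem_univ _, hj⟩
  have := card_erase_add_one hl
  omega

end Pendant

/-! ### The minimization program -/

/-- Inclusion of regions. -/
def Region.Sub (A B : Region) : Prop :=
  A.nat ⊆ B.nat ∧ A.real ⊆ B.real ∧ A.natArr ⊆ B.natArr ∧ A.realArr ⊆ B.realArr

instance (A B : Region) : Decidable (A.Sub B) := by unfold Region.Sub; infer_instance

theorem Agree.sub {A B : Region} {s s' : State} (h : Agree A s s') (hAB : A.Sub B) :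
    Agree B s s' := h.mono hAB.1 hAB.2.1 hAB.2.2.1 hAB.2.2.2

/-- Natural number register: loop counter of `fill`. -/
abbrev idxReg : ℕ := 10
/-- Natural number register: the label of the candidate. -/
abbrev labReg : ℕ := 11
/-- Natural number register: the number of the phase. -/
abbrev phaseReg : ℕ := 12
/-- Natural number register: the number of the step in the phase. -/
abbrev stepReg : ℕ := 13
/-- Natural number register: the candidate. -/
abbrev candReg : ℕ := 14
/-- Natural number register: whether a candidate has been found. -/
abbrev foundReg : ℕ := 15
/-- Natural number register: the label of the best candidate. -/
abbrev bestLabReg : ℕ := 16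
/-- Natural number register: the label of the last group of the legal order. -/
abbrev lastReg : ℕ := 17
/-- Natural number register: the label of the last group but one of the legal order. -/
abbrev prevReg : ℕ := 18
/-- Real number register: the key of the candidate. -/
abbrev keyReg : ℕ := 10
/-- Real number register: the key of the best candidate. -/
abbrev bestKeyReg : ℕ := 11
/-- Real number register: the least value found. -/
abbrev bestReg : ℕ := 12
/-- Natural number array: the labels of the groups. -/
abbrev groupArr : ℕ := 10
/-- Natural number array: the initial segment of the legal order. -/
abbrev inArr : ℕ := 11

/-- The memory that the subroutine may change. -/
def calleeRegion : Region := ⟨[3, 4], [0, 1, 2], [], []⟩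

/-- The memory that the minimization and its subroutine may change. -/
def minimizeRegion : Region :=
  ⟨[3, 4, idxReg, labReg, phaseReg, stepReg, candReg, foundReg, bestLabReg, lastReg, prevReg],
    [0, 1, 2, keyReg, bestKeyReg, bestReg], [queryArr, outArr, groupArr, inArr], []⟩

/-- In states with the property `Inv`, a call of the subroutine returns a value of `f` and takes,
with the call itself, at most `τ` operations. -/
structure Computes {n : ℕ} (Q : State → State → ℕ → Prop) (f : Finset (Fin n) → ℝ) (τ : ℕ)
    (Inv : State → Prop) : Prop where
  frames : Frames calleeRegion Q
  call : ∀ s, Inv s → ∃ s' t, Q s s' t ∧ t + 1 ≤ τ ∧ s'.real answerReg = f (s.readSet queryArr n)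
  size : ∀ s, Inv s → s.nat sizeReg = n
  stable : ∀ s s', Agree minimizeRegion s s' → Inv s → Inv s'

/-! ### Writing groups into arrays and querying the function -/

/-- Store the value of `d` in the cells of `a` that belong to the group with label `u`, and the
value of `e` in the other cells. -/
def fill (a u : ℕ) (d e : NatExpr) : Cmd :=
  forTo idxReg sizeReg (.branch (natEq (.get groupArr (.reg idxReg)) (.reg u))
    (.storeNat a (.reg idxReg) d) (.storeNat a (.reg idxReg) e))

/-- When round `i` begins, cell `i` of `a` is still untouched. Hence `d` and `e` may read this cell,
and `a` may even be `groupArr`, whose labels the test reads; both kinds of update in place are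
needed later. -/
theorem Runs.fill {Q : State → State → ℕ → Prop} {W : Region} (hQ : Frames W Q) {s : State}
    {a u n : ℕ} {d e : NatExpr} (D E : ℕ → ℕ) (hu : u ≠ idxReg) (hn : s.nat sizeReg = n)
    (hdc : d.cost ≤ 2) (hec : e.cost ≤ 2)
    (hd : ∀ i s', Agree ⟨[idxReg], [], [a], []⟩ s s' → s'.nat idxReg = i →
      s'.natArr a i = s.natArr a i → d.eval s' = D i)
    (he : ∀ i s', Agree ⟨[idxReg], [], [a], []⟩ s s' → s'.nat idxReg = i →
      s'.natArr a i = s.natArr a i → e.eval s' = E i) :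
    Runs Q (Corr.fill a u d e) s (n * 24 + 6) 0 fun s' =>
      ∀ i < n, s'.natArr a i = if s.natArr groupArr i = s.nat u then D i else E i := by
  refine (Runs.forTo hQ (T := 16) (K := 0) (fun i s' =>
    (∀ k < i, s'.natArr a k = if s.natArr groupArr k = s.nat u then D k else E k) ∧
      ∀ k, i ≤ k → s'.natArr a k = s.natArr a k) hn (by decide) ?_ ?_ ?_ ?_).mono (by omega)
      (by omega) fun s' h => h.1
  · simp [Cmd.writes, Region.union]
  · simp [Cmd.writes, Region.union]
  · exact ⟨by simp, fun k _ => rfl⟩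
  · rintro i s' hi ⟨h₁, h₂⟩ hx hA
    have hA' : Agree ⟨[idxReg], [], [a], []⟩ s s' := by
      refine hA.mono ?_ ?_ ?_ ?_ <;> simp [Corr.forTo, Cmd.writes, Region.union]
    have hg : s'.natArr groupArr i = s.natArr groupArr i := by
      by_cases hag : groupArr = a
      · rw [hag]; exact h₂ i le_rfl
      · rw [hA'.natArr groupArr (by simpa using hag)]
    have hu' : s'.nat u = s.nat u := hA'.nat u (by simpa using hu)
    have htest : (natEq (.get groupArr (.reg idxReg)) (.reg u)).Holds s' ↔
        s.natArr groupArr i = s.nat u := by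
      rw [holds_natEq]; simp only [NatExpr.eval, hx, hg, hu']
    have hpost : ∀ m, m = (if s.natArr groupArr i = s.nat u then D i else E i) →
        (∀ k < i + 1, ((s'.setNatArr a i m).setNat idxReg (i + 1)).natArr a k =
          if s.natArr groupArr k = s.nat u then D k else E k) ∧
        ∀ k, i + 1 ≤ k → ((s'.setNatArr a i m).setNat idxReg (i + 1)).natArr a k =
          s.natArr a k := by
      intro m hm
      simp only [State.setNatArr, State.setNat, Function.update_self]
      constructor
      · intro k hk
        rcases Nat.lt_succ_iff_lt_or_eq.1 hk with hk | rfl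
        · rw [Function.update_of_ne hk.ne]; exact h₁ k hk
        · simpa using hm
      · intro k hk
        rw [Function.update_of_ne (by omega)]; exact h₂ k (by omega)
    refine (Runs.branch (T := 4) (T' := 4) (K := 0) (K' := 0) ?_ ?_).le
      (by simp [natEq, Test.cost, NatExpr.cost]) (by simp)
    · intro hb
      rw [htest] at hb
      refine (Runs.storeNat ?_).le (by simp only [NatExpr.cost]; omega) le_rfl
      simp only [NatExpr.eval, hx]
      exact hpost _ (by rw [if_pos hb, hd i s' hA' hx (h₂ i le_rfl)])
    · intro hb
      rw [htest] at hb
      refine (Runs.storeNat ?_).le (by simp only [NatExpr.cost]; omega) le_rfl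
      simp only [NatExpr.eval, hx]
      exact hpost _ (by rw [if_neg hb, he i s' hA' hx (h₂ i le_rfl)])

/-- The first `n` cells of the array of labels. -/
def State.labels (s : State) (n : ℕ) : Fin n → ℕ := fun i => s.natArr groupArr i

theorem mem_readSet {s : State} {a n : ℕ} {i : Fin n} :
    i ∈ s.readSet a n ↔ s.natArr a i ≠ 0 := by simp [State.readSet]

theorem readSet_eq_of_fill_group {s s' : State} {a u n : ℕ} (h : ∀ i < n, s'.natArr a i =
    if s.natArr groupArr i = s.nat u then 1 else 0) :
    s'.readSet a n = group (s.labels n) (s.nat u) := by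
  ext i
  rw [mem_readSet, mem_group, h i i.2]
  simp [State.labels]

theorem readSet_eq_of_fill_union {s s' : State} {a u n : ℕ} (h : ∀ i < n, s'.natArr a i =
    if s.natArr groupArr i = s.nat u then 1 else s.natArr inArr i) :
    s'.readSet a n = s.readSet inArr n ∪ group (s.labels n) (s.nat u) := by
  ext i
  rw [mem_union, mem_readSet, mem_readSet, mem_group, h i i.2]
  simp only [State.labels]
  split_ifs with hi <;> simp [hi]

/-- The written region does not depend on `u`, `d` and `e`, so deciding one closed instance is
enough. -/
theorem fill_queryArr_sub {u : ℕ} {d e : NatExpr} :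
    ((fill queryArr u d e).writes calleeRegion).Sub minimizeRegion :=
  show ((fill queryArr 0 (.const 0) (.const 0)).writes calleeRegion).Sub minimizeRegion by decide

/-- Evaluate the function at the union of the group with label `u` and the set given by `e`. -/
def ask (u : ℕ) (e : NatExpr) : Cmd := .seq (fill queryArr u (.const 1) e) .call

section

variable {n : ℕ} {Q : State → State → ℕ → Prop} {f : Finset (Fin n) → ℝ} {τ : ℕ}
  {Inv : State → Prop}

theorem Computes.runs_call (hQ : Computes Q f τ Inv) {s : State} (hs : Inv s) :
    Runs Q .call s τ 1 fun s' => s'.real answerReg = f (s.readSet queryArr n) := by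
  obtain ⟨s', t, h, ht, hf⟩ := hQ.call s hs
  exact ⟨s', _, _, .call h, ht, le_rfl, hf⟩

theorem Computes.runs_ask_group (hQ : Computes Q f τ Inv) {s : State} (hs : Inv s) {u : ℕ}
    (hu : u ≠ idxReg) :
    Runs Q (ask u (.const 0)) s (n * 24 + 6 + τ) 1 fun s' =>
      s'.real answerReg = f (group (s.labels n) (s.nat u)) := by
  refine (Runs.seq_agree hQ.frames (Runs.fill hQ.frames (n := n) (fun _ => 1) (fun _ => 0) hu
    (hQ.size s hs) (by simp [NatExpr.cost]) (by simp [NatExpr.cost]) (fun _ _ _ _ _ => rfl)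
    (fun _ _ _ _ _ => rfl)) fun s' h hA => ?_).le le_rfl (Nat.zero_add 1).le
  rw [← readSet_eq_of_fill_group h]
  exact hQ.runs_call (hQ.stable _ _ (hA.sub fill_queryArr_sub) hs)

theorem Computes.runs_ask_union (hQ : Computes Q f τ Inv) {s : State} (hs : Inv s) {u : ℕ}
    (hu : u ≠ idxReg) :
    Runs Q (ask u (.get inArr (.reg idxReg))) s (n * 24 + 6 + τ) 1 fun s' =>
      s'.real answerReg = f (s.readSet inArr n ∪ group (s.labels n) (s.nat u)) := by
  refine (Runs.seq_agree hQ.frames (Runs.fill hQ.frames (n := n) (fun _ => 1)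
    (fun i => s.natArr inArr i) hu
    (hQ.size s hs) (by simp [NatExpr.cost]) (by simp [NatExpr.cost]) (fun _ _ _ _ _ => rfl)
    (fun i s' hA hi _ => ?_)) fun s' h hA => ?_).le le_rfl (Nat.zero_add 1).le
  · simp only [NatExpr.eval, hi, hA.natArr inArr (by decide)]
  · rw [← readSet_eq_of_fill_union h]
    exact hQ.runs_call (hQ.stable _ _ (hA.sub fill_queryArr_sub) hs)

/-- Compute the key of the candidate. -/
def computeKey : Cmd :=
  .seq (.assignNat labReg (.get groupArr (.reg candReg)))
    (.seq (ask labReg (.get inArr (.reg idxReg)))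
      (.seq (.assignReal keyReg (.reg answerReg))
        (.seq (ask labReg (.const 0)) (.assignReal keyReg (.sub (.reg keyReg) (.reg answerReg))))))

/-- The key of the group with label `r`, if `W` is the initial segment. -/
noncomputable def key (f : Finset (Fin n) → ℝ) (R : Fin n → ℕ) (W : Finset (Fin n)) (r : ℕ) : ℝ :=
  f (W ∪ group R r) - f (group R r)

theorem Agree.labels {A : Region} {s s' : State} (h : Agree A s s') (hA : groupArr ∉ A.natArr) :
    s'.labels n = s.labels n := by
  funext i; simp only [State.labels, h.natArr _ hA]

theorem Agree.readSet {A : Region} {s s' : State} (h : Agree A s s') {a : ℕ} (hA : a ∉ A.natArr) :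
    s'.readSet a n = s.readSet a n := by
  simp only [State.readSet, h.natArr _ hA]

/-- The first value must be saved in `keyReg`, which lies outside `calleeRegion`, since the second
call overwrites `answerReg`. -/
theorem Computes.runs_computeKey (hQ : Computes Q f τ Inv) {s : State} (hs : Inv s) :
    Runs Q computeKey s (n * 48 + 2 * τ + 21) 2 fun s' =>
      s'.nat labReg = s.natArr groupArr (s.nat candReg) ∧
      s'.real keyReg = key f (s.labels n) (s.readSet inArr n)
        (s.natArr groupArr (s.nat candReg)) := by
  unfold computeKey
  refine (Runs.seq_agree hQ.frames (Runs.assignNat (P := fun s' => s'.nat labReg =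
    s.natArr groupArr (s.nat candReg)) (by simp [State.setNat, NatExpr.eval]))
    fun s₁ h₁ hA₁ => ?_).le (T := 3 + (n * 24 + 6 + τ + (2 + (n * 24 + 6 + τ + 4))))
      (K := 0 + (1 + (0 + (1 + 0)))) (by omega) (by omega)
  have hI₁ := hQ.stable _ _ (hA₁.sub (by decide)) hs
  refine Runs.seq_agree hQ.frames (hQ.runs_ask_union hI₁ (by decide)) fun s₂ h₂ hA₂ => ?_
  refine Runs.seq_agree hQ.frames (Runs.assignReal (P := fun s' => s'.real keyReg =
    s₂.real answerReg) (by simp [State.setReal, RealExpr.eval])) fun s₃ h₃ hA₃ => ?_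
  have hA₁₃ := (hA₂.sub (B := minimizeRegion) (by decide)).trans
    (hA₃.sub (B := minimizeRegion) (by decide))
  refine Runs.seq_agree hQ.frames (hQ.runs_ask_group (hQ.stable _ _ hA₁₃ hI₁) (by decide))
    fun s₄ h₄ hA₄ => ?_
  refine (Runs.assignReal ?_).le (by simp [RealExpr.cost]) le_rfl
  have e₁ : s₃.nat labReg = s₁.nat labReg :=
    (hA₃.nat _ (by decide)).trans (hA₂.nat _ (by decide))
  have e₂ : s₃.labels n = s.labels n := (hA₃.labels (by decide)).trans
    ((hA₂.labels (by decide)).trans (hA₁.labels (by decide)))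
  refine ⟨?_, ?_⟩
  · change s₄.nat labReg = _
    rw [hA₄.nat _ (by decide), e₁, h₁]
  · simp only [State.setReal, Function.update_self, RealExpr.eval]
    rw [hA₄.real _ (by decide), h₃, h₂, h₄, e₁, h₁, e₂, hA₁.labels (by decide),
      hA₁.readSet (by decide)]
    rfl

end

/-! ### The next group of a legal order -/

section

variable {n : ℕ} {Q : State → State → ℕ → Prop} {f : Finset (Fin n) → ℝ} {τ : ℕ}
  {Inv : State → Prop}

/-- Update the best candidate. -/
def compareKey : Cmd :=
  .branch
    (.conj (.natLt (.const 0) (.reg foundReg)) (.neg (.realLt (.reg keyReg) (.reg bestKeyReg))))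
    .nop
    (.seq (.assignReal bestKeyReg (.reg keyReg))
      (.seq (.assignNat bestLabReg (.reg labReg)) (.assignNat foundReg (.const 1))))

/-- Examine a candidate. -/
def examine : Cmd :=
  .branch (.natLt (.get inArr (.reg candReg)) (.const 1)) (.seq computeKey compareKey) .nop

/-- Find a group outside the initial segment with the least key. -/
def search : Cmd := .seq (.assignNat foundReg (.const 0)) (forTo candReg sizeReg examine)

/-- The best candidate among the first `u` elements is known. -/
structure SearchInv (f : Finset (Fin n) → ℝ) (R : Fin n → ℕ) (W : Finset (Fin n)) (u : ℕ)
    (s : State) : Prop where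
  none : s.nat foundReg = 0 → ∀ i : Fin n, (i : ℕ) < u → i ∈ W
  some : s.nat foundReg ≠ 0 → ∃ v ∉ W, s.nat bestLabReg = R v ∧
    s.real bestKeyReg = key f R W (R v) ∧
    ∀ i : Fin n, (i : ℕ) < u → i ∉ W → s.real bestKeyReg ≤ key f R W (R i)

theorem runs_compareKey {s : State} {R : Fin n → ℕ} {W : Finset (Fin n)} {u : Fin n}
    (huW : u ∉ W) (h : SearchInv f R W u s) (hl : s.nat labReg = R u)
    (hk : s.real keyReg = key f R W (R u)) :
    Runs Q compareKey s 17 0 fun s' => SearchInv f R W (u + 1) (s'.setNat candReg (u + 1)) := by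
  refine (Runs.branch (T := 1) (T' := 7) (K := 0) (K' := 0) ?_ ?_).le
    (by simp [Test.cost, NatExpr.cost, RealExpr.cost]) (by simp)
  · intro hb
    simp only [Test.Holds, NatExpr.eval, RealExpr.eval, not_lt] at hb
    refine Runs.nop ⟨fun h0 => absurd h0 hb.1.ne', fun _ => ?_⟩
    obtain ⟨v, hv, h₁, h₂, h₃⟩ := h.some hb.1.ne'
    refine ⟨v, hv, h₁, h₂, fun i hi hiW => ?_⟩
    rcases Nat.lt_succ_iff_lt_or_eq.1 hi with hi | hi
    · exact h₃ i hi hiW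
    · obtain rfl : i = u := Fin.ext hi
      rw [← hk]; exact hb.2
  · intro hb
    simp only [Test.Holds, NatExpr.eval, RealExpr.eval, not_and, not_not] at hb
    refine (Runs.seq (Runs.assignReal (P := fun s' => s' = _) rfl) ?_).le (T := 2 + (2 + 2 + 1))
      (K := 0 + (0 + 0)) (by omega) le_rfl
    rintro _ rfl
    refine (Runs.seq (Runs.assignNat (P := fun s' => s' = _) rfl) ?_).le (T := 2 + 2)
      (K := 0 + 0) (by omega) le_rfl
    rintro _ rfl
    refine Runs.assignNat ⟨?_, fun _ => ⟨u, huW, ?_, ?_, ?_⟩⟩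
    · simp [State.setNat, State.setReal, NatExpr.eval]
    · simpa [State.setNat, State.setReal, NatExpr.eval] using hl
    · simpa [State.setNat, State.setReal, RealExpr.eval] using hk
    · intro i hi hiW
      simp only [State.setNat, State.setReal, RealExpr.eval, Function.update_self]
      rcases Nat.lt_succ_iff_lt_or_eq.1 hi with hi | hi
      -- Either there was no earlier candidate at all, or the new key is smaller than the old best
      -- one, which bounds all earlier keys.
      · by_cases hf : s.nat foundReg = 0
        · exact absurd (h.none hf i hi) hiW
        · obtain ⟨v, hv, h₁, h₂, h₃⟩ := h.some hf
          exact (hb (Nat.pos_of_ne_zero hf)).le.trans (h₃ i hi hiW)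
      · obtain rfl : i = u := Fin.ext hi
        exact hk.le

theorem SearchInv.of_agree {R : Fin n → ℕ} {W : Finset (Fin n)} {u : ℕ} {s s' : State}
    {A : Region} (h : SearchInv f R W u s) (hA : Agree A s s') (h₁ : foundReg ∉ A.nat)
    (h₂ : bestLabReg ∉ A.nat) (h₃ : bestKeyReg ∉ A.real) : SearchInv f R W u s' := by
  refine ⟨fun h0 => ?_, fun h0 => ?_⟩
  · rw [hA.nat _ h₁] at h0; exact h.none h0
  · rw [hA.nat _ h₁] at h0
    rw [hA.nat _ h₂, hA.real _ h₃]
    exact h.some h0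

/-- Candidates are elements, not groups: a group is examined once for each of its members. This
wastes evaluations but keeps within `2 * n` of them per search. -/
theorem Computes.runs_search (hQ : Computes Q f τ Inv) {s : State} (hs : Inv s) :
    Runs Q search s (n * (n * 48 + 2 * τ + 60) + 8) (n * 2) fun s' =>
      SearchInv f (s.labels n) (s.readSet inArr n) n s' := by
  unfold search
  refine (Runs.seq_agree hQ.frames (Runs.assignNat (P := fun s' => s'.nat foundReg = 0)
    (by simp [State.setNat, NatExpr.eval])) fun s₁ h₁ hA₁ => ?_).le
    (T := 2 + (n * (n * 48 + 2 * τ + 44 + 8) + 6)) (K := 0 + n * 2)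
    (by nlinarith) (by omega)
  have hI₁ := hQ.stable _ _ (hA₁.sub (by decide)) hs
  refine Runs.forTo hQ.frames _ (hQ.size _ hI₁) (by decide) (by decide) (by decide) ?_ ?_
  · refine ⟨fun _ i hi => absurd hi (Nat.not_lt_zero _), fun h => absurd ?_ h⟩
    simpa [State.setNat] using h₁
  · intro i s' hi h hx hA
    have hA' := (hA₁.sub (B := minimizeRegion) (by decide)).trans (hA.sub (by decide))
    have hI' := hQ.stable _ _ hA' hs
    have eR : s'.labels n = s.labels n := (hA.labels (by decide)).trans (hA₁.labels (by decide))
    have eW : s'.readSet inArr n = s.readSet inArr n :=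
      (hA.readSet (by decide)).trans (hA₁.readSet (by decide))
    have hmem : (⟨i, hi⟩ : Fin n) ∈ s.readSet inArr n ↔ s'.natArr inArr i ≠ 0 := by
      rw [← eW, mem_readSet]
    refine (Runs.branch (T := n * 48 + 2 * τ + 21 + 17) (T' := 1) (K := 2 + 0) (K' := 0)
      (fun hb => ?_) (fun hb => ?_)).le ?_ (by simp)
    · have hiW : (⟨i, hi⟩ : Fin n) ∉ s.readSet inArr n := by
        rw [hmem]; simpa [Test.Holds, NatExpr.eval, hx] using hb
      refine Runs.seq_agree hQ.frames (hQ.runs_computeKey hI') fun s'' h'' hA'' => ?_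
      rw [hx, eR, eW] at h''
      refine runs_compareKey (u := ⟨i, hi⟩) hiW (h.of_agree hA'' (by decide) (by decide)
        (by decide)) ?_ ?_
      · rw [h''.1, ← eR]; rfl
      · rw [h''.2, ← eR]; rfl
    · have hiW : (⟨i, hi⟩ : Fin n) ∈ s.readSet inArr n := by
        rw [hmem]; simpa [Test.Holds, NatExpr.eval, hx] using hb
      refine Runs.nop (SearchInv.of_agree ?_ (Agree.setNat _ _ _) (by decide) (by decide)
        (by decide))
      refine ⟨fun h0 j hj => ?_, fun h0 => ?_⟩
      · rcases Nat.lt_succ_iff_lt_or_eq.1 hj with hj | hj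
        · exact h.none h0 j hj
        · obtain rfl : j = ⟨i, hi⟩ := Fin.ext hj
          exact hiW
      · obtain ⟨v, hv, e₁, e₂, e₃⟩ := h.some h0
        refine ⟨v, hv, e₁, e₂, fun j hj hjW => ?_⟩
        rcases Nat.lt_succ_iff_lt_or_eq.1 hj with hj | hj
        · exact e₃ j hj hjW
        · obtain rfl : j = ⟨i, hi⟩ := Fin.ext hj
          exact absurd hiW hjW
    · simp only [Test.cost, NatExpr.cost]; omega

/-- Append the group found by `search` to the legal order. -/
def extend : Cmd :=
  .branch (.natLt (.const 0) (.reg foundReg))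
    (.seq (.assignNat prevReg (.reg lastReg))
      (.seq (.assignNat lastReg (.reg bestLabReg))
        (fill inArr lastReg (.const 1) (.get inArr (.reg idxReg)))))
    .nop

/-- The first alternative lets surplus rounds do nothing, so that the order can be built in exactly
`n` rounds however few groups there are. -/
theorem Computes.runs_search_extend (hQ : Computes Q f τ Inv) {s : State} (hs : Inv s) :
    Runs Q (.seq search extend) s (n * (n * 48 + 2 * τ + 84) + 23) (n * 2) fun s' =>
      (s.readSet inArr n = univ ∧ s'.readSet inArr n = univ ∧ s'.nat lastReg = s.nat lastReg ∧
        s'.nat prevReg = s.nat prevReg) ∨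
      ∃ v ∉ s.readSet inArr n,
        s'.readSet inArr n = s.readSet inArr n ∪ group (s.labels n) (s.labels n v) ∧
        s'.nat lastReg = s.labels n v ∧ s'.nat prevReg = s.nat lastReg ∧
        ∀ u ∉ s.readSet inArr n, key f (s.labels n) (s.readSet inArr n) (s.labels n v) ≤
          key f (s.labels n) (s.readSet inArr n) (s.labels n u) := by
  refine (Runs.seq_agree hQ.frames (hQ.runs_search hs) fun s₁ h₁ hA₁ => ?_).le
    (T := n * (n * 48 + 2 * τ + 60) + 8 + (n * 24 + 15)) (K := n * 2 + 0)
    (by nlinarith) le_rfl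
  have hI₁ := hQ.stable _ _ (hA₁.sub (by decide)) hs
  refine (Runs.branch (T := 2 + (2 + (n * 24 + 6))) (T' := 1) (K := 0 + (0 + 0)) (K' := 0)
    (fun hb => ?_) fun hb => ?_).le ?_ (by simp)
  · have hf : s₁.nat foundReg ≠ 0 := by
      simpa [Test.Holds, NatExpr.eval, Nat.pos_iff_ne_zero] using hb
    obtain ⟨v, hv, e₁, e₂, e₃⟩ := h₁.some hf
    refine Runs.seq_agree hQ.frames (Runs.assignNat (P := fun s' => s'.nat prevReg =
      s₁.nat lastReg) (by simp [State.setNat, NatExpr.eval])) fun s₂ h₂ hA₂ => ?_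
    refine Runs.seq_agree hQ.frames (Runs.assignNat (P := fun s' => s'.nat lastReg =
      s₂.nat bestLabReg) (by simp [State.setNat, NatExpr.eval])) fun s₃ h₃ hA₃ => ?_
    have hA₁₃ := (hA₂.sub (B := minimizeRegion) (by decide)).trans
      (hA₃.sub (B := minimizeRegion) (by decide))
    refine ((Runs.fill hQ.frames (n := n) (fun _ => 1) (fun i => s₃.natArr inArr i) (by decide)
      (hQ.size _ (hQ.stable _ _ hA₁₃ hI₁))
      (by simp [NatExpr.cost]) (by simp [NatExpr.cost]) (fun _ _ _ _ _ => rfl)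
      (fun i s' hA hi h' => ?_)).agree hQ.frames).mono le_rfl le_rfl ?_
    · simp only [NatExpr.eval, hi, h']
    · rintro s₄ ⟨h₄, hA₄⟩
      have eR : s₃.labels n = s.labels n := (hA₃.labels (by decide)).trans
        ((hA₂.labels (by decide)).trans (hA₁.labels (by decide)))
      have eW : s₃.readSet inArr n = s.readSet inArr n := (hA₃.readSet (by decide)).trans
        ((hA₂.readSet (by decide)).trans (hA₁.readSet (by decide)))
      have el : s₃.nat lastReg = s.labels n v := by
        rw [h₃, hA₂.nat _ (by decide), e₁]
      refine Or.inr ⟨v, hv, ?_, ?_, ?_, fun u hu => ?_⟩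
      · rw [readSet_eq_of_fill_union h₄, eR, eW, el]
      · rw [hA₄.nat _ (by decide), el]
      · rw [hA₄.nat _ (by decide), hA₃.nat _ (by decide), h₂, hA₁.nat _ (by decide)]
      · rw [← e₂]; exact e₃ u u.2 hu
  · have hf : s₁.nat foundReg = 0 := by
      simpa [Test.Holds, NatExpr.eval] using hb
    have hW : s.readSet inArr n = univ := by
      ext i; simpa using h₁.none hf i i.2
    exact Runs.nop (Or.inl ⟨hW, (hA₁.readSet (by decide)).trans hW, hA₁.nat _ (by decide),
      hA₁.nat _ (by decide)⟩)
  · simp only [Test.cost, NatExpr.cost]; omega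

end

/-! ### Legal orders, merging phases and Queyranne's algorithm -/

section

variable {n : ℕ} {Q : State → State → ℕ → Prop} {f : Finset (Fin n) → ℝ} {τ : ℕ}
  {Inv : State → Prop}

/-- Compute the last two groups of a legal order. -/
def order : Cmd :=
  .seq (fill inArr lastReg (.const 0) (.const 0))
    (.seq (.assignNat lastReg (.reg sizeReg))
      (.seq (.assignNat prevReg (.reg sizeReg)) (forTo stepReg sizeReg (.seq search extend))))

/-- The set `W` is an initial segment, with last two groups labelled `m` and `l`, of a legal order
of at least `k` elements, if there are so many. The label `n` stands for a missing group. -/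
structure OrderInv (f : Finset (Fin n) → ℝ) (R : Fin n → ℕ) (k : ℕ) (W : Finset (Fin n))
    (m l : ℕ) : Prop where
  compat : Compat R W
  pendant : Pendant f R W (group R l)
  pair : PendantPair f R W (group R m) (group R l)
  size : W = univ ∨ k ≤ #W
  last : (l = n ∧ W = ∅) ∨ ∃ i ∈ W, R i = l
  prev : (m = n ∧ W ⊆ group R l) ∨ (m ≠ l ∧ ∃ i, R i = m)

/-- For the empty segment only `X = ∅` is admitted, and both inequalities become equalities,
whatever the labels are. -/
theorem OrderInv.start (R : Fin n → ℕ) (m l : ℕ) (hm : m = n) (hl : l = n) :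
    OrderInv f R 0 ∅ m l := by
  refine ⟨fun _ _ _ => by simp, fun X _ hX u _ => ?_, fun X _ hX => ?_, Or.inr (Nat.zero_le _),
    Or.inl ⟨hl, rfl⟩, Or.inl ⟨hm, empty_subset _⟩⟩
  · obtain rfl : X = ∅ := by simpa using hX
    simp
  · obtain rfl : X = ∅ := by simpa using hX
    simp

theorem OrderInv.step (hf : IsSubmodular f) {R : Fin n → ℕ} {k m l : ℕ} {W : Finset (Fin n)}
    (h : OrderInv f R k W m l) {v : Fin n} (hv : v ∉ W)
    (hmin : ∀ u ∉ W, key f R W (R v) ≤ key f R W (R u)) :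
    OrderInv f R (k + 1) (W ∪ group R (R v)) l (R v) := by
  have hvv : v ∈ group R (R v) := mem_group.2 rfl
  refine ⟨h.compat.union (compat_group _), h.pendant.step hf h.compat hv hmin,
    h.pendant.pair h.compat hv, Or.inr ?_, Or.inr ⟨v, mem_union_right _ hvv, rfl⟩, ?_⟩
  · have hk : k ≤ #W := h.size.resolve_left fun hW => hv (by rw [hW]; exact mem_univ _)
    exact hk.trans_lt (card_lt_card ⟨subset_union_left, fun hs => hv (hs (mem_union_right _ hvv))⟩)
  · rcases h.last with ⟨hl, hW⟩ | ⟨i, hi, hl⟩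
    · exact Or.inl ⟨hl, by rw [hW, empty_union]⟩
    · refine Or.inr ⟨fun hlv => hv ((h.compat i v (hl.trans hlv)).1 hi), i, hl⟩

theorem Computes.runs_order (hQ : Computes Q f τ Inv) (hf : IsSubmodular f) {s : State}
    (hs : Inv s) :
    Runs Q order s (n * (n * (n * 48 + 2 * τ + 84) + 55) + 16) (n * (n * 2)) fun s' =>
      OrderInv f (s.labels n) n univ (s'.nat prevReg) (s'.nat lastReg) := by
  unfold order
  refine (Runs.seq_agree hQ.frames (Runs.fill hQ.frames (n := n) (fun _ => 0) (fun _ => 0)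
    (by decide) (hQ.size s hs) (by simp [NatExpr.cost]) (by simp [NatExpr.cost])
    (fun _ _ _ _ _ => rfl) (fun _ _ _ _ _ => rfl)) fun s₁ h₁ hA₁ => ?_).le
    (T := n * 24 + 6 + (2 + (2 + (n * (n * (n * 48 + 2 * τ + 84) + 23 + 8) + 6))))
    (K := 0 + (0 + (0 + n * (n * 2)))) (by nlinarith) (by omega)
  have hI₁ := hQ.stable _ _ (hA₁.sub (by decide)) hs
  refine Runs.seq_agree hQ.frames (Runs.assignNat (P := fun s' => s'.nat lastReg =
    s₁.nat sizeReg) (by simp [State.setNat, NatExpr.eval])) fun s₂ h₂ hA₂ => ?_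
  have hI₂ := hQ.stable _ _ (hA₂.sub (by decide)) hI₁
  refine Runs.seq_agree hQ.frames (Runs.assignNat (P := fun s' => s'.nat prevReg =
    s₂.nat sizeReg) (by simp [State.setNat, NatExpr.eval])) fun s₃ h₃ hA₃ => ?_
  have hI₃ := hQ.stable _ _ (hA₃.sub (by decide)) hI₂
  have eR : s₃.labels n = s.labels n := (hA₃.labels (by decide)).trans
    ((hA₂.labels (by decide)).trans (hA₁.labels (by decide)))
  have eW : s₃.readSet inArr n = ∅ := by
    rw [hA₃.readSet (by decide), hA₂.readSet (by decide)]
    ext i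
    simp [mem_readSet, h₁ i i.2]
  refine (Runs.forTo hQ.frames (fun k s' => OrderInv f (s.labels n) k (s'.readSet inArr n)
    (s'.nat prevReg) (s'.nat lastReg)) (hQ.size _ hI₃) (by decide) (by decide) (by decide)
    ?_ ?_).mono le_rfl le_rfl fun s' h => ?_
  · have hA := Agree.setNat s₃ stepReg 0
    rw [hA.readSet (by decide), hA.nat _ (by decide), hA.nat _ (by decide), eW]
    refine OrderInv.start _ _ _ ?_ ?_
    · rw [h₃, hQ.size _ hI₂]
    · rw [hA₃.nat _ (by decide), h₂, hQ.size _ hI₁]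
  · intro k s' hk h hx hA
    refine (hQ.runs_search_extend (hQ.stable _ _ (hA.sub (by decide)) hI₃)).mono le_rfl le_rfl
      fun s'' h'' => ?_
    have hA'' := Agree.setNat s'' stepReg (k + 1)
    rw [hA''.readSet (by decide), hA''.nat _ (by decide), hA''.nat _ (by decide)]
    rw [hA.labels (by decide), eR] at h''
    rcases h'' with ⟨e₁, e₂, e₃, e₄⟩ | ⟨v, hv, e₁, e₂, e₃, hmin⟩
    · rw [e₁] at h
      rw [e₂, e₃, e₄]
      exact ⟨h.compat, h.pendant, h.pair, Or.inl rfl, h.last, h.prev⟩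
    · rw [e₁, e₂, e₃]
      exact h.step hf hv hmin
  -- Every round added an element unless the segment was already complete, so `n` rounds exhaust the
  -- ground set.
  · have hu : s'.readSet inArr n = univ := h.size.elim id fun hn => by
      rw [← card_eq_iff_eq_univ]
      refine le_antisymm (card_le_univ _) ?_
      simpa using hn
    rwa [hu] at h

/-- Compare the last group of the legal order with the best set found so far. -/
def updateBest : Cmd :=
  .branch (.realLt (.reg answerReg) (.reg bestReg))
    (.seq (.assignReal bestReg (.reg answerReg)) (fill outArr lastReg (.const 1) (.const 0))) .nop

/-- Merge the last two groups of the legal order. -/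
def mergeLast : Cmd :=
  .branch (.natLt (.reg prevReg) (.reg sizeReg))
    (.seq (ask lastReg (.const 0))
      (.seq updateBest (fill groupArr lastReg (.reg prevReg) (.get groupArr (.reg idxReg)))))
    .nop

/-- The best set found so far is a proper nonempty subset, and all better ones are unions of
groups. -/
structure PhaseInv (f : Finset (Fin n) → ℝ) (k : ℕ) (b : ℝ) (X : Finset (Fin n))
    (R : Fin n → ℕ) : Prop where
  value : b = f X
  ne_empty : X ≠ ∅
  ne_univ : X ≠ univ
  opt : ∀ Y : Finset (Fin n), Y ≠ ∅ → Y ≠ univ → f X ≤ f Y ∨ Compat R Y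
  lt : ∀ i, R i < n
  card : (∀ i j, R i = R j) ∨ #(univ.image R) + k ≤ n

/-- A competitor that separates the last two groups is no better than the last group by
`PendantPair.le`, hence no better than `X'`; one that does not separate them remains a union of
groups after the merger. -/
theorem PhaseInv.step {R : Fin n → ℕ} {k m l : ℕ} {X X' : Finset (Fin n)} {b b' : ℝ}
    (h : PhaseInv f k b X R) (hs : IsSymmetric f) (ho : OrderInv f R n univ m l) (hm : m < n)
    (hX' : X' = X ∨ X' = group R l) (hb' : b' = f X') (h₁ : f X' ≤ f X)
    (h₂ : f X' ≤ f (group R l)) : PhaseInv f (k + 1) b' X' (mergeLabels R m l) := by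
  obtain ⟨hml, i, hi⟩ := ho.prev.resolve_left fun hh => hm.ne hh.1
  obtain ⟨j, hj⟩ : ∃ j, R j = l := by
    rcases ho.last with ⟨-, hW⟩ | ⟨j, -, hj⟩
    · exact absurd (hW ▸ mem_univ i) (notMem_empty i)
    · exact ⟨j, hj⟩
  refine ⟨hb', ?_, ?_, fun Y hY hY' => ?_, fun a => ?_, Or.inr ?_⟩
  · rcases hX' with rfl | rfl
    · exact h.ne_empty
    · exact ne_empty_of_mem (mem_group.2 hj)
  · rcases hX' with rfl | rfl
    · exact h.ne_univ
    · intro hu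
      exact hml (hi.symm.trans (mem_group.1 (hu ▸ mem_univ i)))
  · rcases h.opt Y hY hY' with hle | hc
    · exact Or.inl (h₁.trans hle)
    · by_cases hij : i ∈ Y ↔ j ∈ Y
      · exact Or.inr (hc.merge hi hj hij)
      · exact Or.inl (h₂.trans (ho.pair.le hs hc hi hj hij))
  · unfold mergeLabels
    split_ifs
    · exact hm
    · exact h.lt a
  · have hc := h.card.resolve_left fun hall => hml (by rw [← hi, ← hj]; exact hall i j)
    have := card_image_mergeLabels hml hi hj
    omega

theorem Computes.runs_mergeLast (hQ : Computes Q f τ Inv) (hs : IsSymmetric f) {s : State}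
    (hI : Inv s) {k : ℕ}
    (h : PhaseInv f k (s.real bestReg) (s.readSet outArr n) (s.labels n))
    (ho : OrderInv f (s.labels n) n univ (s.nat prevReg) (s.nat lastReg)) :
    Runs Q mergeLast s (n * 72 + τ + 40) 1 fun s' =>
      PhaseInv f (k + 1) (s'.real bestReg) (s'.readSet outArr n) (s'.labels n) := by
  refine (Runs.branch (T := n * 24 + 6 + τ + (4 + (2 + (n * 24 + 6)) + (n * 24 + 6))) (T' := 1)
    (K := 1 + (0 + 0)) (K' := 0) (fun hb => ?_) (fun hb => ?_)).le ?_ (by simp)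
  · have hm : s.nat prevReg < n := by
      simpa [Test.Holds, NatExpr.eval, hQ.size _ hI] using hb
    refine Runs.seq_agree hQ.frames (hQ.runs_ask_group hI (by decide)) fun s₁ h₁ hA₁ => ?_
    have hI₁ := hQ.stable _ _ (hA₁.sub (by decide)) hI
    have hbest : s₁.real bestReg = f (s.readSet outArr n) := by
      rw [hA₁.real _ (by decide), h.value]
    refine Runs.seq_agree hQ.frames (P := fun s' => s'.real bestReg = f (s'.readSet outArr n) ∧
      (s'.readSet outArr n = s.readSet outArr n ∨
        s'.readSet outArr n = group (s.labels n) (s.nat lastReg)) ∧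
      f (s'.readSet outArr n) ≤ f (s.readSet outArr n) ∧
      f (s'.readSet outArr n) ≤ f (group (s.labels n) (s.nat lastReg))) ?_
      fun s₂ h₂ hA₂ => ?_
    · refine (Runs.branch (T := 2 + (n * 24 + 6)) (T' := 1) (K := 0 + 0) (K' := 0)
        (fun hb => ?_) (fun hb => ?_)).le (by simp [Test.cost, RealExpr.cost]; omega) (by simp)
      · replace hb : s₁.real answerReg < s₁.real bestReg := hb
        refine Runs.seq_agree hQ.frames (Runs.assignReal (P := fun s' => s'.real bestReg =
          s₁.real answerReg) (by simp [State.setReal, RealExpr.eval])) fun s₂ h₂ hA₂ => ?_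
        have hI₂ := hQ.stable _ _ (hA₂.sub (by decide)) hI₁
        refine ((Runs.fill hQ.frames (n := n) (fun _ => 1) (fun _ => 0)
          (by decide) (hQ.size _ hI₂) (by simp [NatExpr.cost]) (by simp [NatExpr.cost])
          (fun _ _ _ _ _ => rfl) (fun _ _ _ _ _ => rfl)).agree hQ.frames).mono le_rfl le_rfl ?_
        rintro s₃ ⟨h₃, hA₃⟩
        have e := readSet_eq_of_fill_group h₃
        rw [hA₂.labels (by decide), hA₁.labels (by decide), hA₂.nat _ (by decide),
          hA₁.nat _ (by decide)] at e
        rw [e, hA₃.real _ (by decide), h₂, h₁]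
        refine ⟨rfl, Or.inr rfl, ?_, le_rfl⟩
        rw [← h₁, ← hbest]
        exact hb.le
      · replace hb : ¬ s₁.real answerReg < s₁.real bestReg := hb
        have e : s₁.readSet outArr n = s.readSet outArr n := hA₁.readSet (by decide)
        refine Runs.nop ?_
        rw [e]
        refine ⟨hbest, Or.inl rfl, le_rfl, ?_⟩
        rw [← h₁, ← hbest]
        exact not_lt.1 hb
    · have hI₂ := hQ.stable _ _ (hA₂.sub (by decide)) hI₁
      have eR : s₂.labels n = s.labels n := (hA₂.labels (by decide)).trans (hA₁.labels (by decide))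
      have el : s₂.nat lastReg = s.nat lastReg :=
        (hA₂.nat _ (by decide)).trans (hA₁.nat _ (by decide))
      have ep : s₂.nat prevReg = s.nat prevReg :=
        (hA₂.nat _ (by decide)).trans (hA₁.nat _ (by decide))
      refine ((Runs.fill hQ.frames (n := n) (fun _ => s.nat prevReg)
        (fun i => s₂.natArr groupArr i) (by decide) (hQ.size _ hI₂) (by simp [NatExpr.cost])
        (by simp [NatExpr.cost]) (fun i s' hA _ _ => ?_)
        (fun i s' hA hi h' => ?_)).agree hQ.frames).mono le_rfl le_rfl ?_
      · simp only [NatExpr.eval]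
        rw [hA.nat _ (by decide), ep]
      · simp only [NatExpr.eval, hi, h']
      · rintro s₃ ⟨h₃, hA₃⟩
        have e : s₃.labels n = mergeLabels (s.labels n) (s.nat prevReg) (s.nat lastReg) := by
          funext i
          rw [← eR]
          rw [← el]
          exact h₃ i i.2
        rw [e, hA₃.real _ (by decide), hA₃.readSet (by decide)]
        exact h.step hs ho hm h₂.2.1 h₂.1 h₂.2.2.1 h₂.2.2.2
  · have hm : ¬ s.nat prevReg < n := by
      simpa [Test.Holds, NatExpr.eval, hQ.size _ hI] using hb
    -- All labels are less than `n`, so a value of `prevReg` that is not below `n` means that there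
    -- is no second group and all labels coincide.
    refine Runs.nop ⟨h.value, h.ne_empty, h.ne_univ, h.opt, h.lt, Or.inl fun i j => ?_⟩
    rcases ho.prev with ⟨-, hW⟩ | ⟨-, i, hi⟩
    · rw [mem_group.1 (hW (mem_univ i)), mem_group.1 (hW (mem_univ j))]
    · exact absurd (hi ▸ h.lt i) hm
  · simp only [Test.cost, NatExpr.cost]; omega

/-- Queyranne's algorithm for the minimization of symmetric submodular functions. -/
def queyranne : Cmd :=
  .seq (fill groupArr lastReg (.reg idxReg) (.reg idxReg))
    (.seq (.assignNat labReg (.const 0))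
      (.seq (fill outArr labReg (.const 1) (.const 0))
        (.seq (ask labReg (.const 0))
          (.seq (.assignReal bestReg (.reg answerReg))
            (forTo phaseReg sizeReg (.seq order mergeLast))))))

/-- The search starts from the discrete labelling and the singleton of element 0, which is a proper
subset because `2 ≤ n`. The evaluations number `2 * n` per step and one more per phase, plus one at
the start. -/
theorem Computes.runs_queyranne (hQ : Computes Q f τ Inv) (hs : IsSymmetric f)
    (hf : IsSubmodular f) (hn : 2 ≤ n) {s : State} (hI : Inv s) :
    Runs Q queyranne s (1000 * (n ^ 3 * (n + τ))) (4 * n ^ 3) fun s' =>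
      s'.readSet outArr n ≠ ∅ ∧ s'.readSet outArr n ≠ univ ∧
        ∀ T : Finset (Fin n), T ≠ ∅ → T ≠ univ → f (s'.readSet outArr n) ≤ f T := by
  unfold queyranne
  refine (Runs.seq_agree hQ.frames (Runs.fill hQ.frames (n := n) (d := .reg idxReg)
    (e := .reg idxReg) id id (by decide) (hQ.size s hI) (by simp [NatExpr.cost]) (by simp [NatExpr.cost])
    (fun _ _ _ h _ => h) (fun _ _ _ h _ => h)) fun s₁ h₁ hA₁ => ?_).le
    (T := n * 24 + 6 + (2 + (n * 24 + 6 + (n * 24 + 6 + τ + (2 +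
      (n * (n * (n * (n * 48 + 2 * τ + 84) + 55) + 16 + (n * 72 + τ + 40) + 8) + 6))))))
    (K := 0 + (0 + (0 + (1 + (0 + n * (n * (n * 2) + 1)))))) ?_ ?_
  · have hI₁ := hQ.stable _ _ (hA₁.sub (by decide)) hI
    have hR₁ : ∀ i, s₁.labels n i = i := fun i => by
      simp only [State.labels, h₁ i i.2, ite_self, id]
    refine Runs.seq_agree hQ.frames (Runs.assignNat (P := fun s' => s'.nat labReg = 0)
      (by simp [State.setNat, NatExpr.eval])) fun s₂ h₂ hA₂ => ?_
    have hI₂ := hQ.stable _ _ (hA₂.sub (by decide)) hI₁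
    refine Runs.seq_agree hQ.frames (Runs.fill hQ.frames (n := n) (fun _ => 1) (fun _ => 0)
      (by decide) (hQ.size _ hI₂) (by simp [NatExpr.cost]) (by simp [NatExpr.cost])
      (fun _ _ _ _ _ => rfl) (fun _ _ _ _ _ => rfl)) fun s₃ h₃ hA₃ => ?_
    have hI₃ := hQ.stable _ _ (hA₃.sub (by decide)) hI₂
    refine Runs.seq_agree hQ.frames (hQ.runs_ask_group hI₃ (by decide)) fun s₄ h₄ hA₄ => ?_
    have hI₄ := hQ.stable _ _ (hA₄.sub (by decide)) hI₃
    refine Runs.seq_agree hQ.frames (Runs.assignReal (P := fun s' => s'.real bestReg =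
      s₄.real answerReg) (by simp [State.setReal, RealExpr.eval])) fun s₅ h₅ hA₅ => ?_
    have hI₅ := hQ.stable _ _ (hA₅.sub (by decide)) hI₄
    have e₃ : s₃.labels n = s₁.labels n := (hA₃.labels (by decide)).trans
      (hA₂.labels (by decide))
    have e₅ : s₅.labels n = s₁.labels n := (hA₅.labels (by decide)).trans
      ((hA₄.labels (by decide)).trans e₃)
    have eout : s₅.readSet outArr n = group (s₁.labels n) 0 := by
      rw [hA₅.readSet (by decide), hA₄.readSet (by decide), readSet_eq_of_fill_group h₃, h₂,
        hA₂.labels (by decide)]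
    refine (Runs.forTo hQ.frames (fun k s' => PhaseInv f k (s'.real bestReg)
      (s'.readSet outArr n) (s'.labels n)) (hQ.size _ hI₅) (by decide) (by decide) (by decide)
      ?_ ?_).mono le_rfl le_rfl fun s' h => ⟨h.ne_empty, h.ne_univ, fun T hT hT' => ?_⟩
    · have hA := Agree.setNat s₅ phaseReg 0
      rw [hA.readSet (by decide), hA.labels (by decide), hA.real _ (by decide), eout, e₅]
      refine ⟨?_, ne_empty_of_mem (a := ⟨0, by omega⟩) (mem_group.2 (hR₁ _)), fun hu => ?_,
        fun Y _ _ => Or.inr fun i j hij => ?_, fun i => ?_, Or.inr ?_⟩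
      · rw [h₅, h₄, e₃, hA₃.nat _ (by decide), h₂]
      · have := mem_group.1 (hu ▸ mem_univ (⟨1, by omega⟩ : Fin n))
        rw [hR₁] at this
        exact one_ne_zero this
      · rw [hR₁, hR₁] at hij
        rw [Fin.ext hij]
      · rw [hR₁]; exact i.2
      · have : #(univ.image (s₁.labels n)) ≤ #(univ : Finset (Fin n)) := card_image_le
        simpa using this
    · intro k s' hk h hx hA
      have hI' := hQ.stable _ _ (hA.sub (by decide)) hI₅
      refine Runs.seq_agree hQ.frames (hQ.runs_order hf hI') fun s'' h'' hA'' => ?_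
      have eR : s''.labels n = s'.labels n := hA''.labels (by decide)
      refine (hQ.runs_mergeLast hs (hQ.stable _ _ (hA''.sub (by decide)) hI') (k := k) ?_ ?_).mono
        le_rfl le_rfl fun s''' h''' => ?_
      · rw [eR, hA''.readSet (by decide), hA''.real _ (by decide)]
        exact h
      · rw [eR]; exact h''
      · have hA := Agree.setNat s''' phaseReg (k + 1)
        rw [hA.readSet (by decide), hA.labels (by decide), hA.real _ (by decide)]
        exact h'''
    -- After `n` phases the bound on the number of labels would leave no label, so all labels agree,
    -- and a nonempty union of groups is everything.
    · refine (h.opt T hT hT').resolve_right fun hc => ?_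
      have hall : ∀ i j, s'.labels n i = s'.labels n j := h.card.resolve_right fun hcard => by
        have : #(univ.image (s'.labels n)) = 0 := by omega
        rw [card_eq_zero, image_eq_empty] at this
        exact absurd (this ▸ mem_univ (⟨0, by omega⟩ : Fin n)) (notMem_empty _)
      obtain ⟨i, hi⟩ := nonempty_iff_ne_empty.2 hT
      exact hT' (eq_univ_of_forall fun j => (hc i j (hall i j)).1 hi)
  -- The nested products are abbreviated from the inside out, with `L = n * (n + τ)` and `M = n *
  -- L`, which keeps every comparison of low degree.
  · have hn1 : 1 ≤ n := by omega
    have a₁ : n * 48 + 2 * τ + 84 ≤ 132 * (n + τ) := by omega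
    generalize n * 48 + 2 * τ + 84 = A at a₁
    have a₂ : n * A ≤ 132 * (n * (n + τ)) := by nlinarith
    have b₁ : n + τ ≤ n * (n + τ) := Nat.le_mul_of_pos_left _ hn1
    generalize n * A = B at a₂
    generalize hL : n * (n + τ) = L at *
    have a₃ : n * (B + 55) ≤ 187 * (n * L) := by nlinarith
    have b₂ : L ≤ n * L := Nat.le_mul_of_pos_left _ hn1
    generalize n * (B + 55) = D at a₃
    generalize hM : n * L = M at *
    have a₄ : n * (D + 16 + (n * 72 + τ + 40) + 8) ≤ 400 * (n * M) := by nlinarith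
    have b₃ : M ≤ n * M := Nat.le_mul_of_pos_left _ hn1
    have e : n ^ 3 * (n + τ) = n * M := by rw [← hM, ← hL]; ring
    rw [e]
    omega
  · have hn3 : n ≤ n ^ 3 := Nat.le_self_pow (by norm_num) n
    have hn1 : 1 ≤ n ^ 3 := Nat.one_le_pow _ _ (by omega)
    have : n * (n * (n * 2) + 1) = 2 * n ^ 3 + n := by ring
    omega

/-- Here `τ = 2`, one unit for the oracle and one for the call; the factor 2000 comes from `n + 2 ≤
2 * n`. -/
theorem minimizesSymmetricSubmodular_queyranne {C : ℕ} (hC : 2000 ≤ C) :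
    MinimizesSymmetricSubmodular queyranne C := by
  intro n f hn hs hf s hsn
  have hQ : Computes (oracle f) f 2 fun s => s.nat sizeReg = n := by
    refine ⟨?_, fun s _ => ⟨_, 1, ⟨rfl, rfl⟩, le_rfl, by simp [State.setReal]⟩, fun _ h => h,
      fun s s' hA h => (hA.nat _ (by decide)).trans h⟩
    rintro s s' t ⟨rfl, -⟩
    refine Agree.sub (A := ⟨[], [0], [], []⟩) ⟨fun _ _ => rfl, fun y hy => ?_, fun _ _ => rfl,
      fun _ _ => rfl⟩ (by decide)
    rw [List.mem_singleton] at hy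
    simp [State.setReal, Function.update_of_ne hy]
  obtain ⟨s', t, q, h, ht, hq, h₁, h₂, h₃⟩ := hQ.runs_queyranne hs hf hn hsn
  refine ⟨s', t, q, h, hq.trans (Nat.mul_le_mul_right _ (by omega)), ht.trans ?_, h₁, h₂, h₃⟩
  calc 1000 * (n ^ 3 * (n + 2)) ≤ 1000 * (n ^ 3 * (n + n)) := by gcongr
    _ = 2000 * n ^ 4 := by ring
    _ ≤ C * n ^ 4 := by gcongr

end

/-! ### The minimum over the subsets of the second partition -/

section

variable {V : Type*} [DecidableEq V] {w : V → ℝ}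

theorem mem_unionOf {S : Finset (Finset V)} {v : V} : v ∈ unionOf S ↔ ∃ X ∈ S, v ∈ X := by
  simp [unionOf]

theorem weight_inter_add_weight_sdiff (U X : Finset V) :
    weight w (U ∩ X) + weight w (X \ U) = weight w X := by
  rw [inter_comm]
  exact sum_inter_add_sum_sdiff X U w

variable [Fintype V]

theorem weight_eq_sum_parts (P : Finpartition (univ : Finset V)) (Y : Finset V) :
    weight w Y = ∑ X ∈ P.parts, weight w (Y ∩ X) := by
  have h : Y = P.parts.biUnion fun X => Y ∩ X := by
    rw [← inter_biUnion, show P.parts.biUnion (fun X => X) = univ from P.biUnion_parts, inter_univ]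
  conv_lhs => rw [h]
  unfold weight
  rw [sum_biUnion]
  intro X hX X' hX' hne
  exact (P.disjoint hX hX' hne).mono inter_subset_right inter_subset_right

/-- Since parts are disjoint, `X` lies inside `U_𝒮'` or is disjoint from it. -/
theorem symmDiff_unionOf_inter {P : Finpartition (univ : Finset V)} {S' : Finset (Finset V)}
    (hS' : S' ⊆ P.parts) (U : Finset V) {X : Finset V} (hX : X ∈ P.parts) :
    symmDiff U (unionOf S') ∩ X = if X ∈ S' then X \ U else U ∩ X := by
  have key : ∀ v ∈ X, v ∈ unionOf S' ↔ X ∈ S' := by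
    intro v hv
    rw [mem_unionOf]
    constructor
    · rintro ⟨Y, hY, hvY⟩
      rwa [← P.eq_of_mem_parts (hS' hY) hX hvY hv]
    · exact fun h => ⟨X, h, hv⟩
  ext v
  by_cases hv : v ∈ X
  · have := key v hv
    split_ifs with h <;> simp [mem_symmDiff, this, h, hv]
  · split_ifs with h <;> simp [hv]

theorem phi_eq_sum {P' : Finpartition (univ : Finset V)} {S S' : Finset (Finset V)}
    (hS' : S' ⊆ P'.parts) :
    phi w S S' = ∑ X ∈ P'.parts,
      if X ∈ S' then weight w (X \ unionOf S) else weight w (unionOf S ∩ X) := by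
  rw [phi, weight_eq_sum_parts P']
  refine sum_congr rfl fun X hX => ?_
  rw [symmDiff_unionOf_inter hS' _ hX, apply_ite (weight w)]

theorem partner_subset (P' : Finpartition (univ : Finset V)) (S : Finset (Finset V)) :
    partner w P' S ⊆ P'.parts := filter_subset _ _

/-- Covering more than half of `X` means that including `X` is strictly cheaper than leaving it out;
in a tie both options cost the same. -/
theorem phi_partner (P' : Finpartition (univ : Finset V)) (S : Finset (Finset V)) :
    phi w S (partner w P' S) = ∑ X ∈ P'.parts,
      min (weight w (unionOf S ∩ X)) (weight w (X \ unionOf S)) := by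
  rw [phi_eq_sum (partner_subset _ _)]
  refine sum_congr rfl fun X hX => ?_
  have h := weight_inter_add_weight_sdiff (w := w) (unionOf S) X
  simp only [partner, mem_filter, hX, true_and]
  split_ifs with hh
  · rw [min_eq_right (by linarith)]
  · rw [min_eq_left (by linarith)]

theorem phiMin_eq_phi_partner (P' : Finpartition (univ : Finset V)) (S : Finset (Finset V)) :
    phiMin w P' S = phi w S (partner w P' S) := by
  refine le_antisymm (inf'_le _ (mem_powerset.2 (partner_subset _ _)))
    (le_inf' _ _ fun S' hS' => ?_)
  rw [phi_partner, phi_eq_sum (mem_powerset.1 hS')]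
  refine sum_le_sum fun X _ => ?_
  split_ifs
  · exact min_le_right _ _
  · exact min_le_left _ _

theorem phiMin_le_phi {P' : Finpartition (univ : Finset V)} (S : Finset (Finset V))
    {S' : Finset (Finset V)} (hS' : S' ⊆ P'.parts) : phiMin w P' S ≤ phi w S S' :=
  inf'_le _ (mem_powerset.2 hS')

/-! ### The minimum as a symmetric submodular function of the overlaps -/

/-- The weights of the intersections of the parts of two partitions. -/
def overlap (w : V → ℝ) {P P' : Finpartition (univ : Finset V)} (e : Fin #P.parts ≃ P.parts)
    (e' : Fin #P'.parts ≃ P'.parts) (i : Fin #P.parts) (j : Fin #P'.parts) : ℝ :=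
  weight w ((e i : Finset V) ∩ (e' j : Finset V))

variable {P P' : Finpartition (univ : Finset V)} (e : Fin #P.parts ≃ P.parts)
  (e' : Fin #P'.parts ≃ P'.parts)

theorem mem_unionOf_partsOf {X : Finset (Fin #P.parts)} {v : V} :
    v ∈ unionOf (partsOf e X) ↔ ∃ i ∈ X, v ∈ (e i : Finset V) := by
  simp [mem_unionOf, partsOf]

theorem eq_of_mem_of_mem {i j : Fin #P.parts} {v : V} (hi : v ∈ (e i : Finset V))
    (hj : v ∈ (e j : Finset V)) : i = j :=
  e.injective (Subtype.ext (P.eq_of_mem_parts (e i).2 (e j).2 hi hj))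

theorem exists_mem_part (v : V) : ∃ i, v ∈ (e i : Finset V) := by
  obtain ⟨X, hX, hv⟩ := P.exists_mem (mem_univ v)
  exact ⟨e.symm ⟨X, hX⟩, by simpa using hv⟩

theorem unionOf_partsOf_compl (X : Finset (Fin #P.parts)) :
    unionOf (partsOf e Xᶜ) = (unionOf (partsOf e X))ᶜ := by
  ext v
  rw [mem_compl, mem_unionOf_partsOf, mem_unionOf_partsOf]
  obtain ⟨i, hi⟩ := exists_mem_part e v
  constructor
  · rintro ⟨j, hj, hvj⟩ ⟨k, hk, hvk⟩
    rw [eq_of_mem_of_mem e hvj hvk, mem_compl] at hj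
    exact hj hk
  · exact fun h => ⟨i, mem_compl.2 fun hiX => h ⟨i, hiX, hi⟩, hi⟩

theorem weight_unionOf_partsOf_inter (X : Finset (Fin #P.parts)) (j : Fin #P'.parts) :
    weight w (unionOf (partsOf e X) ∩ (e' j : Finset V)) = ∑ i ∈ X, overlap w e e' i j := by
  have h : unionOf (partsOf e X) ∩ (e' j : Finset V) =
      X.biUnion fun i => (e i : Finset V) ∩ (e' j : Finset V) := by
    ext v
    simp only [mem_inter, mem_unionOf_partsOf, mem_biUnion]
    tauto
  rw [h, weight, sum_biUnion]
  · rfl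
  · intro i _ k _ hik
    rw [Function.onFun, disjoint_left]
    intro v hv hv'
    exact hik (eq_of_mem_of_mem e (mem_inter.1 hv).1 (mem_inter.1 hv').1)

theorem weight_sdiff_unionOf_partsOf (X : Finset (Fin #P.parts)) (j : Fin #P'.parts) :
    weight w ((e' j : Finset V) \ unionOf (partsOf e X)) = ∑ i ∈ Xᶜ, overlap w e e' i j := by
  rw [← weight_unionOf_partsOf_inter, unionOf_partsOf_compl, inter_comm, sdiff_eq_inter_compl]

/-- The sum of the smaller halves of the columns of a matrix, if the rows are split into `X` and
its complement. -/
noncomputable def halves {n n' : ℕ} (μ : Fin n → Fin n' → ℝ) (X : Finset (Fin n)) : ℝ :=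
  ∑ j, min (∑ i ∈ X, μ i j) (∑ i ∈ Xᶜ, μ i j)

theorem phiMin_partsOf (X : Finset (Fin #P.parts)) :
    phiMin w P' (partsOf e X) = halves (overlap w e e') X := by
  rw [phiMin_eq_phi_partner, phi_partner, halves, ← sum_coe_sort, ← e'.sum_comp]
  exact sum_congr rfl fun j _ => by
    rw [weight_unionOf_partsOf_inter, weight_sdiff_unionOf_partsOf]

theorem isSymmetric_halves {n n' : ℕ} (μ : Fin n → Fin n' → ℝ) : IsSymmetric (halves μ) := by
  intro X
  simp only [halves, compl_compl]
  exact sum_congr rfl fun j _ => min_comm _ _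

theorem isSubmodular_halves {n n' : ℕ} {μ : Fin n → Fin n' → ℝ} (hμ : ∀ i j, 0 ≤ μ i j) :
    IsSubmodular (halves μ) := by
  intro S T
  simp only [halves]
  rw [← sum_add_distrib, ← sum_sub_distrib]
  refine sum_le_sum fun j _ => ?_
  have h := sum_union_inter (s₁ := S) (s₂ := T) (f := fun i => μ i j)
  have hc : ∀ X : Finset (Fin n), ∑ i ∈ Xᶜ, μ i j = ∑ i, μ i j - ∑ i ∈ X, μ i j := fun X => by
    rw [← sum_add_sum_compl X fun i => μ i j]; ring
  have hm : ∀ {X Y : Finset (Fin n)}, X ⊆ Y → ∑ i ∈ X, μ i j ≤ ∑ i ∈ Y, μ i j := fun hXY =>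
    sum_le_sum_of_subset_of_nonneg hXY fun i _ _ => hμ i j
  have h₁ := hm (inter_subset_left (s₁ := S) (s₂ := T))
  have h₂ := hm (inter_subset_right (s₁ := S) (s₂ := T))
  rw [hc, hc, hc, hc]
  generalize ∑ i ∈ S ∪ T, μ i j = a at *
  generalize ∑ i ∈ S ∩ T, μ i j = d at *
  generalize ∑ i ∈ S, μ i j = b at *
  generalize ∑ i ∈ T, μ i j = c at *
  -- What remains is concavity of `min x (c - x)`: the values satisfy `a + d = b + c`, with `d` at
  -- most `b` and `c`. Nonnegativity of `μ` enters only through these two inequalities.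
  rcases min_cases b (∑ i, μ i j - b) with h₃ | h₃ <;>
  rcases min_cases c (∑ i, μ i j - c) with h₄ | h₄ <;>
  rcases min_cases a (∑ i, μ i j - a) with h₅ | h₅ <;>
  rcases min_cases d (∑ i, μ i j - d) with h₆ | h₆ <;> linarith

theorem overlap_nonneg (hw : ∀ v, 0 ≤ w v) (i : Fin #P.parts) (j : Fin #P'.parts) :
    0 ≤ overlap w e e' i j := sum_nonneg fun v _ => hw v

theorem mem_partsOf {X : Finset (Fin #P.parts)} {i : Fin #P.parts} :
    (e i : Finset V) ∈ partsOf e X ↔ i ∈ X := by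
  simp only [partsOf, mem_image]
  constructor
  · rintro ⟨k, hk, h⟩
    rwa [← e.injective (Subtype.ext h)]
  · exact fun h => ⟨i, h, rfl⟩

theorem partsOf_subset (X : Finset (Fin #P.parts)) : partsOf e X ⊆ P.parts := by
  intro Y hY
  obtain ⟨i, -, rfl⟩ := mem_image.1 hY
  exact (e i).2

theorem partsOf_injective : Function.Injective (partsOf e) := by
  intro X Y h
  ext i
  rw [← mem_partsOf e, h, mem_partsOf]

theorem partsOf_univ : partsOf e univ = P.parts := by
  refine (partsOf_subset e _).antisymm fun X hX => ?_
  rw [show X = (e (e.symm ⟨X, hX⟩) : Finset V) by simp, mem_partsOf]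
  exact mem_univ _

/-- Every set of parts comes from a set of indices; this carries minimality from index sets back to
subsets of `𝒫`. -/
theorem partsOf_filter {T : Finset (Finset V)} (hT : T ⊆ P.parts) :
    partsOf e (univ.filter fun i => (e i : Finset V) ∈ T) = T := by
  ext X
  constructor
  · intro hX
    obtain ⟨i, hi, rfl⟩ := mem_image.1 hX
    exact (mem_filter.1 hi).2
  · intro hX
    have h : X = (e (e.symm ⟨X, hT hX⟩) : Finset V) := by simp
    rw [h, mem_partsOf, mem_filter]
    exact ⟨mem_univ _, by rwa [← h]⟩

theorem partsOf_empty : partsOf e ∅ = ∅ := by simp [partsOf]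

end

/-! ### Preparation, evaluation and computation of the partner -/

/-- Natural number register: loop counter. -/
abbrev rowReg : ℕ := 3
/-- Natural number register: loop counter. -/
abbrev colReg : ℕ := 4
/-- Natural number register: the next free address. -/
abbrev addrReg : ℕ := 5
/-- Natural number array: the addresses of the rows of the table. -/
abbrev rowArr : ℕ := 5
/-- Real number array: the table of overlaps. -/
abbrev tableArr : ℕ := 1
/-- Real number register: the part of the column sum that belongs to the set. -/
abbrev inSumReg : ℕ := 1
/-- Real number register: the part of the column sum that belongs to the complement. -/
abbrev outSumReg : ℕ := 2

/-- The memory holds the matrix `μ`. -/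
structure Table {n n' : ℕ} (μ : Fin n → Fin n' → ℝ) (s : State) : Prop where
  rows : s.nat sizeReg = n
  cols : s.nat numPartsReg' = n'
  entry : ∀ (i : Fin n) (j : Fin n'), s.realArr tableArr (s.natArr rowArr i + j) = μ i j

theorem Table.of_agree {n n' : ℕ} {μ : Fin n → Fin n' → ℝ} {A : Region} {s s' : State}
    (h : Table μ s) (hA : Agree A s s') (h₁ : sizeReg ∉ A.nat) (h₂ : numPartsReg' ∉ A.nat)
    (h₃ : rowArr ∉ A.natArr) (h₄ : tableArr ∉ A.realArr) : Table μ s' :=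
  ⟨(hA.nat _ h₁).trans h.rows, (hA.nat _ h₂).trans h.cols, fun i j => by
    rw [hA.natArr _ h₃, hA.realArr _ h₄, h.entry]⟩

/-- The entry of the current row and column. -/
def entryExpr : RealExpr := .get tableArr (.add (.get rowArr (.reg rowReg)) (.reg colReg))

/-- Add up the current column, separately over the set in array `a` and its complement. -/
def splitColumn (a : ℕ) : Cmd :=
  .seq (.assignReal inSumReg .zero)
    (.seq (.assignReal outSumReg .zero)
      (forTo rowReg sizeReg (.branch (.natLt (.const 0) (.get a (.reg rowReg)))
        (.assignReal inSumReg (.add (.reg inSumReg) entryExpr))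
        (.assignReal outSumReg (.add (.reg outSumReg) entryExpr)))))

section

variable {n n' : ℕ} {μ : Fin n → Fin n' → ℝ} {Q : State → State → ℕ → Prop} {W : Region}

theorem runs_splitColumn (hQ : Frames W Q) (a : ℕ) {s : State} (hs : Table μ s) {j : Fin n'}
    (hj : s.nat colReg = j) :
    Runs Q (splitColumn a) s (n * 22 + 10) 0 fun s' =>
      s'.real inSumReg = ∑ i ∈ s.readSet a n, μ i j ∧
      s'.real outSumReg = ∑ i ∈ (s.readSet a n)ᶜ, μ i j := by
  refine (Runs.seq_agree hQ (Runs.assignReal (P := fun s' => s'.real inSumReg = 0)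
    (by simp [State.setReal, RealExpr.eval])) fun s₁ h₁ hA₁ => ?_).le
    (T := 2 + (2 + (n * (14 + 8) + 6))) (K := 0 + (0 + n * 0)) (by omega) (by omega)
  refine Runs.seq_agree hQ (Runs.assignReal (P := fun s' => s'.real outSumReg = 0)
    (by simp [State.setReal, RealExpr.eval])) fun s₂ h₂ hA₂ => ?_
  have hs₂ : Table μ s₂ := (hs.of_agree hA₁ (by simp [Cmd.writes]) (by simp [Cmd.writes])
    (by simp [Cmd.writes]) (by simp [Cmd.writes])).of_agree hA₂ (by simp [Cmd.writes])
    (by simp [Cmd.writes]) (by simp [Cmd.writes]) (by simp [Cmd.writes])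
  let m : ℕ → ℝ := fun i => s.realArr tableArr (s.natArr rowArr i + j)
  have hm : ∀ i : Fin n, m i = μ i j := fun i => hs.entry i j
  refine (Runs.forTo hQ (fun k s' =>
    s'.real inSumReg = ∑ i ∈ range k, (if s.natArr a i ≠ 0 then m i else 0) ∧
    s'.real outSumReg = ∑ i ∈ range k, (if s.natArr a i ≠ 0 then 0 else m i)) hs₂.rows
    (by decide) (by simp [Cmd.writes, Region.union]) (by simp [Cmd.writes, Region.union])
    ?_ ?_).mono le_rfl le_rfl fun s' h => ?_
  · have hA := Agree.setNat s₂ rowReg 0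
    rw [hA.real _ (by simp), hA.real _ (by simp), hA₂.real _ (by simp [Cmd.writes]), h₁, h₂]
    simp
  · rintro k s' hk ⟨h₃, h₄⟩ hx hA
    have hrow : s'.natArr rowArr = s.natArr rowArr := by
      rw [hA.natArr _ (by simp [forTo, Cmd.writes, Region.union]),
        hA₂.natArr _ (by simp [Cmd.writes]), hA₁.natArr _ (by simp [Cmd.writes])]
    have ha : s'.natArr a = s.natArr a := by
      rw [hA.natArr _ (by simp [forTo, Cmd.writes, Region.union]),
        hA₂.natArr _ (by simp [Cmd.writes]), hA₁.natArr _ (by simp [Cmd.writes])]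
    have ht : s'.realArr tableArr = s.realArr tableArr := by
      rw [hA.realArr _ (by simp [forTo, Cmd.writes, Region.union]),
        hA₂.realArr _ (by simp [Cmd.writes]), hA₁.realArr _ (by simp [Cmd.writes])]
    have hcol : s'.nat colReg = j := by
      rw [hA.nat _ (by simp [forTo, Cmd.writes, Region.union]),
        hA₂.nat _ (by simp [Cmd.writes]), hA₁.nat _ (by simp [Cmd.writes]), hj]
    have he : entryExpr.eval s' = m k := by
      simp only [entryExpr, RealExpr.eval, NatExpr.eval, hrow, ht, hcol, hx, m]
    have htest : (Test.natLt (.const 0) (.get a (.reg rowReg))).Holds s' ↔ s.natArr a k ≠ 0 := by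
      simp only [Test.Holds, NatExpr.eval, ha, hx, Nat.pos_iff_ne_zero]
    refine (Runs.branch (T := 8) (T' := 8) (K := 0) (K' := 0) (fun hb => ?_) (fun hb => ?_)).le
      (by simp [Test.cost, NatExpr.cost]) (by simp)
    · rw [htest] at hb
      refine (Runs.assignReal ?_).le (by simp [RealExpr.cost, NatExpr.cost, entryExpr]) le_rfl
      rw [sum_range_succ, sum_range_succ, if_pos hb, if_pos hb]
      constructor
      · simp only [State.setNat, State.setReal, Function.update_self, RealExpr.eval, h₃, he]
      · simp only [State.setNat, State.setReal]
        rw [Function.update_of_ne (by decide), h₄, add_zero]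
    · rw [htest] at hb
      refine (Runs.assignReal ?_).le (by simp [RealExpr.cost, NatExpr.cost, entryExpr]) le_rfl
      rw [sum_range_succ, sum_range_succ, if_neg hb, if_neg hb]
      constructor
      · simp only [State.setNat, State.setReal]
        rw [Function.update_of_ne (by decide), h₃, add_zero]
      · simp only [State.setNat, State.setReal, Function.update_self, RealExpr.eval, h₄, he]
  · rw [h.1, h.2, sum_range, sum_range]
    simp only [hm]
    constructor
    · rw [State.readSet, sum_filter]
    · rw [State.readSet, compl_filter, sum_filter]
      exact sum_congr rfl fun i _ => by split_ifs <;> simp_all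

/-- Evaluate `halves μ` at the query set. -/
def evaluateHalves : Cmd :=
  .seq (.assignReal answerReg .zero)
    (forTo colReg numPartsReg' (.seq (splitColumn queryArr)
      (.branch (.realLt (.reg inSumReg) (.reg outSumReg))
        (.assignReal answerReg (.add (.reg answerReg) (.reg inSumReg)))
        (.assignReal answerReg (.add (.reg answerReg) (.reg outSumReg))))))

theorem runs_evaluateHalves (hQ : Frames calleeRegion Q) {s : State} (hs : Table μ s) :
    Runs Q evaluateHalves s (n' * (n * 22 + 26) + 8) 0 fun s' =>
      s'.real answerReg = halves μ (s.readSet queryArr n) := by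
  refine (Runs.seq_agree hQ (Runs.assignReal (P := fun s' => s'.real answerReg = 0)
    (by simp [State.setReal, RealExpr.eval])) fun s₁ h₁ hA₁ => ?_).le
    (T := 2 + (n' * (n * 22 + 10 + 8 + 8) + 6)) (K := 0 + n' * 0) (by nlinarith) (by omega)
  have hs₁ : Table μ s₁ := hs.of_agree hA₁ (by decide) (by decide) (by decide) (by decide)
  -- The loop invariant sums over `range k`, which requires a function on `ℕ`; the default 0 never
  -- enters, as `k` stays at most `n'`.
  let g : ℕ → ℝ := fun k => if hk : k < n' then
    min (∑ i ∈ s.readSet queryArr n, μ i ⟨k, hk⟩) (∑ i ∈ (s.readSet queryArr n)ᶜ, μ i ⟨k, hk⟩)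
    else 0
  refine (Runs.forTo hQ (fun k s' => s'.real answerReg = ∑ j ∈ range k, g j) hs₁.cols
    (by decide) (by decide) (by decide) ?_ ?_).mono le_rfl le_rfl fun s' h => ?_
  · rw [(Agree.setNat s₁ colReg 0).real _ (by simp), h₁, sum_range_zero]
  · intro k s' hk h hx hA
    have hs' : Table μ s' := hs₁.of_agree hA (by decide) (by decide) (by decide) (by decide)
    have hq : s'.readSet queryArr n = s.readSet queryArr n :=
      (hA.readSet (by decide)).trans (hA₁.readSet (by decide))
    refine (Runs.seq_agree hQ (runs_splitColumn hQ queryArr hs' (j := ⟨k, hk⟩) hx)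
      (T' := 8) (K' := 0) fun s'' h'' hA'' => ?_)
    rw [hq] at h''
    have hans : s''.real answerReg = ∑ j ∈ range k, g j :=
      (hA''.real _ (by decide)).trans h
    have hg : g k = min (s''.real inSumReg) (s''.real outSumReg) := by
      simp only [g, hk, dif_pos, h''.1, h''.2]
    refine (Runs.branch (T := 4) (T' := 4) (K := 0) (K' := 0) (fun hb => ?_) (fun hb => ?_)).le
      (by simp [Test.cost, RealExpr.cost]) (by simp)
    · replace hb : s''.real inSumReg < s''.real outSumReg := hb
      refine (Runs.assignReal ?_).le (by simp [RealExpr.cost]) le_rfl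
      simp only [State.setNat, State.setReal, Function.update_self, RealExpr.eval]
      rw [sum_range_succ, hans, hg, min_eq_left hb.le]
    · replace hb : ¬ s''.real inSumReg < s''.real outSumReg := hb
      refine (Runs.assignReal ?_).le (by simp [RealExpr.cost]) le_rfl
      simp only [State.setNat, State.setReal, Function.update_self, RealExpr.eval]
      rw [sum_range_succ, hans, hg, min_eq_right (not_lt.1 hb)]
  · rw [h, sum_range, halves]
    exact sum_congr rfl fun j _ => by simp [g]

/-- Find the columns the larger half of which belongs to the output set. -/
def majorColumns : Cmd :=
  forTo colReg numPartsReg' (.seq (splitColumn outArr)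
    (.branch (.realLt (.reg outSumReg) (.reg inSumReg))
      (.storeNat outArr' (.reg colReg) (.const 1)) (.storeNat outArr' (.reg colReg) (.const 0))))

theorem runs_majorColumns (hQ : Frames calleeRegion Q) {s : State} (hs : Table μ s) :
    Runs Q majorColumns s (n' * (n * 22 + 25) + 6) 0 fun s' =>
      s'.readSet outArr n = s.readSet outArr n ∧
      ∀ j, j ∈ s'.readSet outArr' n' ↔
        ∑ i ∈ (s.readSet outArr n)ᶜ, μ i j < ∑ i ∈ s.readSet outArr n, μ i j := by
  refine ((Runs.forTo hQ (T := n * 22 + 10 + 7) (K := 0) (fun k s' => ∀ j : Fin n', (j : ℕ) < k →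
    (s'.natArr outArr' j ≠ 0 ↔
      ∑ i ∈ (s.readSet outArr n)ᶜ, μ i j < ∑ i ∈ s.readSet outArr n, μ i j)) hs.cols
    (by decide) (by decide) (by decide) (fun j hj => absurd hj (Nat.not_lt_zero _)) ?_).agree
    hQ).mono (by nlinarith) (by omega) fun s' h => ?_
  · intro k s' hk h hx hA
    have hs' : Table μ s' := hs.of_agree hA (by decide) (by decide) (by decide) (by decide)
    refine (Runs.seq_agree hQ (runs_splitColumn hQ outArr hs' (j := ⟨k, hk⟩) hx)
      (T' := 7) (K' := 0) fun s'' h'' hA'' => ?_)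
    rw [hA.readSet (by decide)] at h''
    have hcol : s''.nat colReg = k := (hA''.nat _ (by decide)).trans hx
    have hold : s''.natArr outArr' = s'.natArr outArr' := hA''.natArr _ (by decide)
    have hpost : ∀ m, (m ≠ 0 ↔ s''.real outSumReg < s''.real inSumReg) → ∀ j : Fin n',
        (j : ℕ) < k + 1 → (((s''.setNatArr outArr' k m).setNat colReg (k + 1)).natArr outArr' j ≠ 0
          ↔ ∑ i ∈ (s.readSet outArr n)ᶜ, μ i j < ∑ i ∈ s.readSet outArr n, μ i j) := by
      intro m hm j hj
      simp only [State.setNat, State.setNatArr, Function.update_self]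
      rcases Nat.lt_succ_iff_lt_or_eq.1 hj with hj | hj
      · rw [Function.update_of_ne hj.ne, hold]
        exact h j hj
      · obtain rfl : j = ⟨k, hk⟩ := Fin.ext hj
        rw [Function.update_self, hm, h''.1, h''.2]
    refine (Runs.branch (T := 3) (T' := 3) (K := 0) (K' := 0) (fun hb => ?_) (fun hb => ?_)).le
      (by simp [Test.cost, RealExpr.cost]) (by simp)
    · replace hb : s''.real outSumReg < s''.real inSumReg := hb
      refine (Runs.storeNat ?_).le (by simp [NatExpr.cost]) le_rfl
      simp only [NatExpr.eval, hcol]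
      exact hpost _ (by simp [hb])
    · replace hb : ¬ s''.real outSumReg < s''.real inSumReg := hb
      refine (Runs.storeNat ?_).le (by simp [NatExpr.cost]) le_rfl
      simp only [NatExpr.eval, hcol]
      exact hpost _ (by simpa using hb)
  · exact ⟨h.2.readSet (by decide), fun j => by rw [mem_readSet]; exact h.1 j j.2⟩

/-! ### Building the table of overlaps -/

/-- Lay out the table and set its entries to zero. -/
def clearTable : Cmd :=
  .seq (.assignNat addrReg (.const 0))
    (forTo rowReg sizeReg (.seq (.storeNat rowArr (.reg rowReg) (.reg addrReg))
      (forTo colReg numPartsReg' (.seq (.storeReal tableArr (.reg addrReg) .zero)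
        (.assignNat addrReg (.add (.reg addrReg) (.const 1)))))))

/-- The machine cannot multiply, so the row addresses `i * n'` are obtained by counting the cells
while they are cleared, and are stored for later use. -/
theorem runs_clearTable (hQ : Frames calleeRegion Q) {s : State} (hn : s.nat sizeReg = n)
    (hn' : s.nat numPartsReg' = n') :
    Runs Q clearTable s (n * (n' * 15 + 17) + 8) 0 fun s' =>
      (∀ i < n, s'.natArr rowArr i = i * n') ∧ ∀ k < n * n', s'.realArr tableArr k = 0 := by
  refine (Runs.seq_agree hQ (Runs.assignNat (P := fun s' => s'.nat addrReg = 0)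
    (by simp [State.setNat, NatExpr.eval])) fun s₁ h₁ hA₁ => ?_).le
    (T := 2 + (n * (3 + (n' * (3 + 4 + 8) + 6) + 8) + 6)) (K := 0 + n * (0 + n' * 0))
    (by nlinarith) (by simp)
  refine (Runs.forTo hQ (fun i s' => s'.nat addrReg = i * n' ∧
    (∀ k < i, s'.natArr rowArr k = k * n') ∧ ∀ k < i * n', s'.realArr tableArr k = 0)
    ((hA₁.nat _ (by decide)).trans hn)
    (by decide) (by decide) (by decide) ?_ ?_).mono le_rfl le_rfl fun s' h => h.2
  · refine ⟨?_, fun k hk => absurd hk (Nat.not_lt_zero _), fun k hk => by omega⟩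
    rw [(Agree.setNat s₁ rowReg 0).nat _ (by decide), h₁, Nat.zero_mul]
  · rintro i s₂ hi ⟨h₂, h₃, h₄⟩ hx hA₂
    refine Runs.seq_agree hQ ((Runs.storeNat (P := fun s' => s' = _) rfl).le (T' := 3)
      (by simp [NatExpr.cost]) le_rfl) fun s₃ hs₃ hA₃ => ?_
    have hrow : ∀ k < i + 1, s₃.natArr rowArr k = k * n' := by
      intro k hk
      simp only [hs₃, State.setNatArr, Function.update_self, NatExpr.eval, hx]
      rcases Nat.lt_succ_iff_lt_or_eq.1 hk with hk | rfl
      · rw [Function.update_of_ne hk.ne, h₃ k hk]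
      · rw [Function.update_self, h₂]
    have hc : s₃.nat numPartsReg' = n' := by
      rw [hA₃.nat _ (by decide), hA₂.nat _ (by decide), hA₁.nat _ (by decide), hn']
    refine ((Runs.forTo hQ (fun j s' => s'.nat addrReg = i * n' + j ∧
      ∀ k < i * n' + j, s'.realArr tableArr k = 0) hc
      (by decide) (by decide) (by decide) ?_ ?_).agree hQ).mono le_rfl le_rfl fun s' h => ?_
    · have hA := Agree.setNat s₃ colReg 0
      rw [hA.nat _ (by decide), hA.realArr _ (by simp), hA₃.nat _ (by decide),
        hA₃.realArr _ (by decide)]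
      exact ⟨h₂, h₄⟩
    · rintro j s₄ hj ⟨h₅, h₆⟩ hx' hA₄
      refine Runs.seq_agree hQ (T' := 4) (K' := 0) ((Runs.storeReal (i := .reg addrReg) (e := .zero)
        (P := fun s' => s' = _) rfl).le (T' := 3)
        (by simp [NatExpr.cost, RealExpr.cost]) le_rfl) fun s₅ hs₅ hA₅ => ?_
      refine (Runs.assignNat ?_).le (by simp [NatExpr.cost]) le_rfl
      subst hs₅
      simp only [State.setNat, State.setRealArr, NatExpr.eval, RealExpr.eval, h₅]
      refine ⟨?_, fun k hk => ?_⟩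
      · rw [Function.update_of_ne (by decide), Function.update_self, add_assoc]
      · rw [Function.update_self]
        by_cases hk' : k = i * n' + j
        · rw [hk', Function.update_self]
        · rw [Function.update_of_ne hk']
          exact h₆ k (by omega)
    · have hA := Agree.setNat s' rowReg (i + 1)
      rw [hA.nat _ (by decide), hA.natArr _ (by simp), hA.realArr _ (by simp), h.1.1,
        h.2.natArr _ (by decide), Nat.succ_mul]
      exact ⟨rfl, hrow, h.1.2⟩

/-- The address of the table entry to which the weight of the current element belongs. -/
def addrExpr : NatExpr :=
  .add (.get rowArr (.get labelArr (.reg rowReg))) (.get labelArr' (.reg rowReg))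

/-- Add the weight of each element to its table entry. -/
def addWeights : Cmd :=
  forTo rowReg numElemReg
    (.storeReal tableArr addrExpr (.add (.get tableArr addrExpr) (.get weightArr (.reg rowReg))))

/-- Row-major addresses do not collide, so adding a weight changes one table entry only. -/
theorem mul_add_inj {i a j b m : ℕ} (hj : j < m) (hb : b < m) :
    i * m + j = a * m + b ↔ i = a ∧ j = b := by
  constructor
  · intro h
    have hm : 0 < m := by omega
    have h₁ : (i * m + j) / m = (a * m + b) / m := by rw [h]
    rw [Nat.mul_comm i, Nat.mul_comm a, Nat.mul_add_div hm, Nat.mul_add_div hm,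
      Nat.div_eq_of_lt hj, Nat.div_eq_of_lt hb] at h₁
    have h₂ : i = a := h₁
    subst h₂
    exact ⟨rfl, by omega⟩
  · rintro ⟨rfl, rfl⟩
    rfl

theorem runs_addWeights (hQ : Frames calleeRegion Q) {s : State} {N : ℕ}
    (hN : s.nat numElemReg = N) (hrow : ∀ i < n, s.natArr rowArr i = i * n')
    (hzero : ∀ k < n * n', s.realArr tableArr k = 0) (hlab : ∀ v < N, s.natArr labelArr v < n)
    (hlab' : ∀ v < N, s.natArr labelArr' v < n') :
    Runs Q addWeights s (N * 26 + 6) 0 fun s' => ∀ i < n, ∀ j < n',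
      s'.realArr tableArr (i * n' + j) = ∑ v ∈ range N,
        if s.natArr labelArr v = i ∧ s.natArr labelArr' v = j then s.realArr weightArr v else 0 := by
  refine (Runs.forTo hQ (T := 18) (K := 0) (fun k s' => ∀ i < n, ∀ j < n',
    s'.realArr tableArr (i * n' + j) = ∑ v ∈ range k,
      if s.natArr labelArr v = i ∧ s.natArr labelArr' v = j then s.realArr weightArr v else 0) hN
    (by decide) (by decide) (by decide) ?_ ?_).le (by omega) (by omega)
  · intro i hi j hj
    rw [(Agree.setNat s rowReg 0).realArr _ (by simp), sum_range_zero]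
    refine hzero _ ?_
    calc i * n' + j < i * n' + n' := by omega
      _ = (i + 1) * n' := by ring
      _ ≤ n * n' := Nat.mul_le_mul_right _ hi
  · intro k s' hk h hx hA
    have haddr : addrExpr.eval s' = s.natArr labelArr k * n' + s.natArr labelArr' k := by
      simp only [addrExpr, NatExpr.eval, hx]
      rw [hA.natArr _ (by decide), hA.natArr _ (by decide), hA.natArr _ (by decide),
        hrow _ (hlab k hk)]
    refine (Runs.storeReal ?_).le (by simp [addrExpr, NatExpr.cost, RealExpr.cost]) le_rfl
    intro i hi j hj
    simp only [State.setNat, State.setRealArr, Function.update_self, RealExpr.eval, NatExpr.eval,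
      haddr, hx]
    rw [sum_range_succ]
    by_cases hij : s.natArr labelArr k = i ∧ s.natArr labelArr' k = j
    · rw [if_pos hij, hij.1, hij.2, Function.update_self, h i hi j hj,
        hA.realArr weightArr (by decide)]
    · rw [if_neg hij, add_zero, Function.update_of_ne, h i hi j hj]
      rw [Ne, mul_add_inj hj (hlab' k hk)]
      exact fun hh => hij ⟨hh.1.symm, hh.2.symm⟩

end

/-! ### Correctness of the three programs for partitions -/

section

variable {V : Type*} [Fintype V] [DecidableEq V] {w : V → ℝ}
  {P P' : Finpartition (univ : Finset V)} {eV : Fin (Fintype.card V) ≃ V}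
  {e : Fin #P.parts ≃ P.parts} {e' : Fin #P'.parts ≃ P'.parts}

/-- The converse holds because every element lies in some part, whose index is then its label. -/
theorem label_eq_iff {lab : ℕ → ℕ} (h : ∀ (v : Fin (Fintype.card V)) (i : Fin #P.parts),
    eV v ∈ (e i : Finset V) → lab v = i) (v : Fin (Fintype.card V)) (i : Fin #P.parts) :
    lab v = i ↔ eV v ∈ (e i : Finset V) := by
  refine ⟨fun hi => ?_, h v i⟩
  obtain ⟨k, hk⟩ := exists_mem_part e (eV v)
  have : k = i := Fin.ext ((h v k hk).symm.trans hi)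
  rwa [← this]

theorem label_lt {lab : ℕ → ℕ} (h : ∀ (v : Fin (Fintype.card V)) (i : Fin #P.parts),
    eV v ∈ (e i : Finset V) → lab v = i) (v : ℕ) (hv : v < Fintype.card V) :
    lab v < #P.parts := by
  obtain ⟨k, hk⟩ := exists_mem_part e (eV ⟨v, hv⟩)
  exact (h ⟨v, hv⟩ k hk).trans_lt k.2

/-- Compute the table of overlaps. -/
def computeTable : Cmd := .seq clearTable addWeights

theorem runs_computeTable {Q : State → State → ℕ → Prop} (hQ : Frames calleeRegion Q) {s : State}
    (hs : IsInput s w P P' eV e e') :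
    Runs Q computeTable s
      (#P.parts * (#P'.parts * 15 + 17) + 8 + (Fintype.card V * 26 + 6)) 0
      (Table (overlap w e e')) := by
  refine ((Runs.seq_agree hQ (runs_clearTable hQ hs.numParts hs.numParts') (K' := 0)
    fun s₁ h₁ hA₁ => runs_addWeights hQ (n := #P.parts) (n' := #P'.parts)
      ((hA₁.nat _ (by decide)).trans hs.numElem) h₁.1 h₁.2 ?_ ?_ |>.agree hQ |>.mono le_rfl le_rfl
      (R := Table (overlap w e e')) ?_))
  · rw [hA₁.natArr _ (by decide)]
    exact label_lt hs.label
  · rw [hA₁.natArr _ (by decide)]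
    exact label_lt hs.label'
  · rintro s₂ ⟨h₂, hA₂⟩
    refine ⟨?_, ?_, fun i j => ?_⟩
    · rw [hA₂.nat _ (by decide), hA₁.nat _ (by decide), hs.numParts]
    · rw [hA₂.nat _ (by decide), hA₁.nat _ (by decide), hs.numParts']
    · rw [hA₂.natArr _ (by decide), h₁.1 i i.2, h₂ i i.2 j j.2, sum_range,
        hA₁.natArr _ (by decide), hA₁.natArr _ (by decide), hA₁.realArr _ (by decide)]
      simp only [label_eq_iff hs.label, label_eq_iff hs.label', hs.weights]
      rw [eV.sum_comp fun v =>
        if v ∈ (e i : Finset V) ∧ v ∈ (e' j : Finset V) then w v else 0, ← sum_filter, overlap,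
        weight]
      refine sum_congr ?_ fun _ _ => rfl
      ext v
      simp

/-- The invariant is the table itself, which lies outside `minimizeRegion`. The constant 9 is the 8
of `runs_evaluateHalves` and one unit for the call. -/
theorem computes_evaluation :
    Computes (evaluation evaluateHalves w P P' e) (halves (overlap w e e'))
      (#P'.parts * (#P.parts * 22 + 26) + 9) (Table (overlap w e e')) := by
  refine ⟨fun s s' t h => (h.1.agree (Frames.false calleeRegion)).sub (by decide), fun s hs => ?_,
    fun s hs => hs.rows,
    fun s s' hA hs => hs.of_agree hA (by decide) (by decide) (by decide) (by decide)⟩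
  obtain ⟨s', t, q, h, ht, hq, ha⟩ := runs_evaluateHalves (Frames.false calleeRegion) hs
  obtain rfl : q = 0 := by omega
  exact ⟨s', t, ⟨h, by rw [ha, phiMin_partsOf e e']⟩, by omega, ha⟩

theorem partsOf_eq_partner {X : Finset (Fin #P.parts)} {Y : Finset (Fin #P'.parts)}
    (h : ∀ j, j ∈ Y ↔ ∑ i ∈ Xᶜ, overlap w e e' i j < ∑ i ∈ X, overlap w e e' i j) :
    partsOf e' Y = partner w P' (partsOf e X) := by
  -- With the partner written as the image of its index set, it remains to compare indices:
  -- exceeding the complementary sum is the same as exceeding half of the total.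
  refine (partsOf_injective e').eq_iff.2 ?_ |>.trans (partsOf_filter e' (partner_subset P' _))
  ext j
  rw [h, mem_filter, partner, mem_filter]
  have h₁ := weight_inter_add_weight_sdiff (w := w) (unionOf (partsOf e X)) (e' j : Finset V)
  rw [weight_unionOf_partsOf_inter, weight_sdiff_unionOf_partsOf] at h₁
  rw [weight_unionOf_partsOf_inter, ← h₁]
  simp only [mem_univ, true_and, (e' j).2]
  constructor <;> intro h₂ <;> linarith

end

/-- Only the preparation depends on `N`. As `n` and `n'` are positive, every other term is at most a
multiple of `n ^ 3 * (n * n')`; the minimization dominates with `58 = 1 + 22 + 26 + 9`, times 1000.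
-/
theorem total_cost_le {N n n' t₁ t₂ t₃ : ℕ} (hn : 1 ≤ n) (hn' : 1 ≤ n')
    (h₁ : t₁ ≤ n * (n' * 15 + 17) + 8 + (N * 26 + 6))
    (h₂ : t₂ ≤ 1000 * (n ^ 3 * (n + (n' * (n * 22 + 26) + 9))))
    (h₃ : t₃ ≤ n' * (n * 22 + 25) + 6) : t₁ + t₂ + t₃ ≤ 100000 * (N + n ^ 4 * n') := by
  have a₁ : 1 ≤ n * n' := Nat.mul_pos hn hn'
  have a₂ : n ≤ n * n' := Nat.le_mul_of_pos_right _ hn'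
  have a₃ : n' ≤ n * n' := Nat.le_mul_of_pos_left _ hn
  have e : n ^ 4 * n' = n ^ 3 * (n * n') := by ring
  have a₄ : n * n' ≤ n ^ 3 * (n * n') := Nat.le_mul_of_pos_left _ (Nat.pow_pos hn)
  have a₅ : n ^ 3 * (n + (n' * (n * 22 + 26) + 9)) ≤ n ^ 3 * (58 * (n * n')) :=
    Nat.mul_le_mul_left _ (by nlinarith)
  have a₆ : n * (n' * 15 + 17) ≤ 32 * (n * n') := by nlinarith
  have a₇ : n' * (n * 22 + 25) ≤ 47 * (n * n') := by nlinarith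
  have a₈ : n ^ 3 * (58 * (n * n')) = 58 * (n ^ 3 * (n * n')) := by ring
  rw [e]
  omega

end Corr

theorem proposition5 :
    ∃ (C : ℕ) (prepare minimize evaluate findPartner : Cmd),
      MinimizesSymmetricSubmodular minimize C ∧
      ∀ (V : Type*) [Fintype V] [DecidableEq V] (w : V → ℝ)
        (P P' : Finpartition (univ : Finset V))
        (eV : Fin (Fintype.card V) ≃ V) (e : Fin #P.parts ≃ P.parts)
        (e' : Fin #P'.parts ≃ P'.parts) (s : State),
        (∀ v, 0 ≤ w v) → 2 ≤ #P.parts → IsInput s w P P' eV e e' →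
        ∃ (s₁ s₂ s₃ : State) (t₁ t₂ t₃ q : ℕ) (S S' : Finset (Finset V)),
          -- the program `prepare; minimize; findPartner` with the subroutine `evaluate`,
          -- which is called in the second phase only
          Exec (fun _ _ _ => False) prepare s s₁ t₁ 0 ∧
          Exec (evaluation evaluate w P P' e) minimize s₁ s₂ t₂ q ∧
          Exec (fun _ _ _ => False) findPartner s₂ s₃ t₃ 0 ∧
          -- running time and number of evaluations
          t₁ + t₂ + t₃ ≤ C * (Fintype.card V + #P.parts ^ 4 * #P'.parts) ∧
          q ≤ C * #P.parts ^ 3 ∧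
          -- the set found by the minimization
          S = partsOf e (s₂.readSet outArr #P.parts) ∧
          S ⊆ P.parts ∧ S ≠ ∅ ∧ S ≠ P.parts ∧
          (∀ T, T ⊆ P.parts → T ≠ ∅ → T ≠ P.parts → phiMin w P' S ≤ phiMin w P' T) ∧
          -- the output
          S = partsOf e (s₃.readSet outArr #P.parts) ∧
          S' = partsOf e' (s₃.readSet outArr' #P'.parts) ∧
          S' = partner w P' S ∧
          IsOptimalCPCorrespondence w P P' S S' := by
  refine ⟨100000, computeTable, queyranne, evaluateHalves, majorColumns,
    minimizesSymmetricSubmodular_queyranne (by norm_num), ?_⟩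
  intro V _ _ w P P' eV e e' s hw hP hs
  have hfalse := Frames.false calleeRegion
  obtain ⟨s₁, t₁, q₁, hx₁, ht₁, hq₁, hs₁⟩ := runs_computeTable hfalse hs
  obtain rfl : q₁ = 0 := by omega
  have hQ := computes_evaluation (w := w) (P := P) (P' := P') (e := e) (e' := e')
  obtain ⟨s₂, t₂, q₂, hx₂, ht₂, hq₂, hne, hnu, hmin⟩ := hQ.runs_queyranne
    (isSymmetric_halves _) (isSubmodular_halves (overlap_nonneg e e' hw)) hP hs₁
  -- Neither the minimization nor its subroutine writes to the table, so the last phase can still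
  -- use it.
  have hs₂ : Table (overlap w e e') s₂ :=
    hQ.stable _ _ ((hx₂.agree hQ.frames).sub (by decide)) hs₁
  obtain ⟨s₃, t₃, q₃, hx₃, ht₃, hq₃, hout, hout'⟩ := runs_majorColumns hfalse hs₂
  obtain rfl : q₃ = 0 := by omega
  -- A part of `𝒫` is nonempty, so `V` has an element, and this lies in a part of `𝒫'`.
  have hn' : 1 ≤ #P'.parts := by
    obtain ⟨X, hX⟩ := card_pos.1 (show 0 < #P.parts by omega)
    obtain ⟨v, -⟩ := P.nonempty_of_mem_parts hX
    obtain ⟨Y, hY, -⟩ := P'.exists_mem (mem_univ v)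
    exact card_pos.2 ⟨Y, hY⟩
  have hSne : partsOf e (s₂.readSet outArr #P.parts) ≠ ∅ := by
    rw [← partsOf_empty e]; exact (partsOf_injective e).ne hne
  have hSnu : partsOf e (s₂.readSet outArr #P.parts) ≠ P.parts :=
    fun h => hnu (partsOf_injective e (h.trans (partsOf_univ e).symm))
  have hopt : ∀ T, T ⊆ P.parts → T ≠ ∅ → T ≠ P.parts →
      phiMin w P' (partsOf e (s₂.readSet outArr #P.parts)) ≤ phiMin w P' T := by
    intro T hT hT₀ hT₁
    rw [← partsOf_filter e hT] at hT₀ hT₁ ⊢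
    rw [phiMin_partsOf e e', phiMin_partsOf e e']
    exact hmin _ (fun h => hT₀ (by rw [h, partsOf_empty]))
      (fun h => hT₁ (by rw [h, partsOf_univ]))
  refine ⟨s₁, s₂, s₃, t₁, t₂, t₃, q₂, _, _, hx₁, hx₂, hx₃,
    total_cost_le (by omega) hn' ht₁ ht₂ ht₃, hq₂.trans (Nat.mul_le_mul_right _ (by norm_num)),
    rfl, partsOf_subset _ _, hSne, hSnu, hopt, by rw [hout], (partsOf_eq_partner hout').symm, rfl,
    ⟨partsOf_subset _ _, partner_subset _ _, hSne, hSnu⟩, ?_⟩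
  rintro T T' ⟨hT, hT', hT₀, hT₁⟩
  -- The partner attains `φ_𝒫'(𝒮)`, which is at most `φ_𝒫'(T)` and thus at most `φ(T, T')`.
  rw [← phiMin_eq_phi_partner]
  exact (hopt T hT hT₀ hT₁).trans (phiMin_le_phi T hT')
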